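/- **Setting.** A network has $K\ge 1$ types of sensors, with $n_k\ge 1$ sensors of type $k$, and $n=\sum_k n_k$. For $\theta\in\{0,1\}$ and $1\le k\le K$ let $p_{\theta,k}$ be a probability density with respect to a common $\sigma$-finite reference measure on the sample space; samples of type-$k$ sensors have density $p_{1,k}$ if the sensor is affected by an anomaly and $p_{0,k}$ otherwise. Let $\mathcal S_{n,0}$ be the set of all labels $\sigma:\{1,\dots,n\}\to\{1,\dots,2K\}$ that take each value $j\le K$ exactly $n_j$ times and no other value, and let $\mathcal S_{n,k}$ be the set of those that take the value $k$ exactly $n_k-1$ times, the value $K+k$ exactly once, each value $j\le K$, $j\ne k$, exactly $n_j$ times, and no other value. Under a label $\sigma$ the data vector $X^n=(X_1,\dots,X_n)$ has independent entries, $X_i$ having density $p_{0,\sigma(i)}$ if $\sigma(i)\le K$ and $p_{1,\sigma(i)-K}$ if $\sigma(i)>K$; write $\mathbb P_{0,\sigma}$ (for $\sigma\in\mathcal S_{n,0}$) and $\mathbb P^k_\sigma$ (for $\sigma\in\mathcal S_{n,k}$) for the law of $X^n$ and for its density. Put $\widetilde{\mathbb P}_0=\frac1{|\mathcal S_{n,0}|}\sum_{\sigma\in\mathcal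 S_{n,0}}\mathbb P_{0,\sigma}$, $\widetilde{\mathbb P}^k=\frac1{|\mathcal S_{n,k}|}\sum_{\sigma\in\mathcal S_{n,k}}\mathbb P^k_\sigma$, $I_k=D(\widetilde{\mathbb P}^k\,\|\,\widetilde{\mathbb P}_0)$ (Kullback–Leibler divergence) and $I^*=\min_k I_k$. Data vectors $X^n[1],X^n[2],\dots$ arrive at the times $1,2,\dots$ and are independent, $X^n[t]$ having an unknown label $\sigma_t$. Let $\mathbb E^\infty_\Omega$ be the expectation when $\Omega=(\sigma_t)_{t\ge1}$ with all $\sigma_t\in\mathcal S_{n,0}$ (no change), and $\mathbb E^{k,\nu}_{\Omega_k}$ the expectation when $\Omega_k=(\sigma_t)_{t\ge1}$ with $\sigma_t\in\mathcal S_{n,0}$ for $t<\nu$ and $\sigma_t\in\mathcal S_{n,k}$ for $t\ge\nu$ (change point $\nu\ge1$, affected sensor of type $k$). For a stopping time $\tau$ let $$\mathrm{WARL}(\tau)=\inf_\Omega\mathbb E^\infty_\Omega[\tau],\qquad \mathrm{WADD}(\tau)=\sup_{\nu\ge1}\sup_{k}\sup_{\Omega_k}\operatorname{ess\,sup}\,\mathbb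 E^{k,\nu}_{\Omega_k}\big[(\tau-\nu)^+\,\big|\,X^n[1],\dots,X^n[\nu-1]\big].$$ The GM-CuSum stopping time with threshold $b$ is $$T_G=\inf\Big\{t\ge1:\ \max_{1\le k\le K}\ \max_{1\le j\le t}\ \sum_{i=j}^t\log\frac{\widetilde{\mathbb P}^k(X^n[i])}{\widetilde{\mathbb P}_0(X^n[i])}\ge b\Big\}.$$ **Theorem.** Let $b=\log(K\gamma)$. 1. For every $\gamma>0$, $\mathrm{WARL}(T_G)\ge\gamma$. 2. Suppose that for every $k$ with $I_k=I^*$ the log-likelihood ratio $\log\frac{\widetilde{\mathbb P}^k(X^n)}{\widetilde{\mathbb P}_0(X^n)}$ has a finite second moment under $\widetilde{\mathbb P}^k$ (in particular $I^*<\infty$). Then, as $\gamma\to\infty$, $$\mathrm{WADD}(T_G)\le\frac{\log\gamma}{I^*}+O(1),$$ where the bound is read as $+\infty$ if $I^*=0$. -/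

import Mathlib

open MeasureTheory Filter
open scoped ENNReal NNReal

noncomputable section

namespace UnlabeledQCD

/-! There are `K` sensor types and `N k` sensors of type `k`, hence `n = ∑ k, N k` sensors.
A group is a pair `(θ, k) : Fin 2 × Fin K`: samples of group `(0, k)` (type `k`, unaffected) have
density `p 0 k` and samples of group `(1, k)` (type `k`, affected) have density `p 1 k`, with
respect to a reference measure `μ` on the sample space `𝒳`. -/

variable {𝒳 : Type*} {K : ℕ}

/-- The unlabeled data vector received at one time step. -/
abbrev Obs (𝒳 : Type*) {K : ℕ} (N : Fin K → ℕ) : Type _ := Fin (∑ k, N k) → 𝒳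

/-- A label assigns to each of the `n` entries of the data vector the group it comes from. -/
abbrev Label {K : ℕ} (N : Fin K → ℕ) : Type := Fin (∑ k, N k) → Fin 2 × Fin K

/-- Number of sensors in each group: `s = none` means that there is no anomaly, `s = some k` that
exactly one sensor, of type `k`, is affected. -/
def groupSize (N : Fin K → ℕ) (s : Option (Fin K)) (g : Fin 2 × Fin K) : ℕ :=
  if g.1 = 0 then (if s = some g.2 then N g.2 - 1 else N g.2)
  else (if s = some g.2 then 1 else 0)

/-- The set of all possible labels: `S_{n,0}` for `s = none`, and `S_{n,k}` for `s = some k`. -/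
def labels (N : Fin K → ℕ) (s : Option (Fin K)) : Finset (Label N) :=
  Finset.univ.filter fun σ =>
    ∀ g, (Finset.univ.filter fun i => σ i = g).card = groupSize N s g

/-- Joint density of the data vector (with respect to `μ^n`) under the label `σ`. -/
def labelDensity (N : Fin K → ℕ) (p : Fin 2 → Fin K → 𝒳 → ℝ≥0) (σ : Label N)
    (x : Obs 𝒳 N) : ℝ≥0 :=
  ∏ i, p (σ i).1 (σ i).2 (x i)

/-- Density of the uniform mixture over all the labels in `labels N s`. -/
def mixDensity (N : Fin K → ℕ) (p : Fin 2 → Fin K → 𝒳 → ℝ≥0) (s : Option (Fin K))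
    (x : Obs 𝒳 N) : ℝ≥0 :=
  ((labels N s).card : ℝ≥0)⁻¹ * ∑ σ ∈ labels N s, labelDensity N p σ x

/-- Log-likelihood ratio of the mixture for an affected sensor of type `k` against the mixture
without anomaly, as an extended real number (`log 0 = -∞`, `log (a / 0) = +∞` for `a > 0`). -/
def logLR (N : Fin K → ℕ) (p : Fin 2 → Fin K → 𝒳 → ℝ≥0) (k : Fin K) (x : Obs 𝒳 N) : EReal :=
  ENNReal.log ((mixDensity N p (some k) x : ℝ≥0∞) / (mixDensity N p none x : ℝ≥0∞))

/-- The statistic `W[t]`, the maximum over `k` and over `1 ≤ j ≤ t` of the sum of the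
log-likelihood ratios at the times `j, …, t`. Here and below `x i` is the data vector received at
time `i + 1`, so that the times `1, 2, …` correspond to the indices `0, 1, …`. -/
def gmStat (N : Fin K → ℕ) (p : Fin 2 → Fin K → 𝒳 → ℝ≥0) (t : ℕ) (x : ℕ → Obs 𝒳 N) : EReal :=
  ⨆ k : Fin K, ⨆ j : Fin t, ∑ i ∈ Finset.Ico (j : ℕ) t, logLR N p k (x i)

/-- The GM-CuSum stopping time `inf {t ≥ 1 : W[t] ≥ b}` (infinite if there is no such `t`). -/
def gmCuSum (N : Fin K → ℕ) (p : Fin 2 → Fin K → 𝒳 → ℝ≥0) (b : ℝ) (x : ℕ → Obs 𝒳 N) : ℕ∞ :=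
  ⨅ (t : ℕ) (_ : 1 ≤ t ∧ (b : EReal) ≤ gmStat N p t x), (t : ℕ∞)

variable [MeasurableSpace 𝒳]

/-- Law of the data vector under the label `σ`: independent entries, the `i`-th one with the
density of the group `σ i`. -/
def labelLaw (μ : Measure 𝒳) (N : Fin K → ℕ) (p : Fin 2 → Fin K → 𝒳 → ℝ≥0) (σ : Label N) :
    Measure (Obs 𝒳 N) :=
  Measure.pi fun i => μ.withDensity fun y => (p (σ i).1 (σ i).2 y : ℝ≥0∞)

/-- The uniform mixture of the laws `labelLaw` over all the labels in `labels N s`. -/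
def mixLaw (μ : Measure 𝒳) (N : Fin K → ℕ) (p : Fin 2 → Fin K → 𝒳 → ℝ≥0)
    (s : Option (Fin K)) : Measure (Obs 𝒳 N) :=
  ((labels N s).card : ℝ≥0∞)⁻¹ • ∑ σ ∈ labels N s, labelLaw μ N p σ

/-- The Kullback-Leibler divergence `I_k` of the two mixtures. -/
def klI (μ : Measure 𝒳) (N : Fin K → ℕ) (p : Fin 2 → Fin K → 𝒳 → ℝ≥0) (k : Fin K) : ℝ≥0∞ :=
  InformationTheory.klDiv (mixLaw μ N p (some k)) (mixLaw μ N p none)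

/-- `I^* = min_k I_k`. -/
def klStar (μ : Measure 𝒳) (N : Fin K → ℕ) (p : Fin 2 → Fin K → 𝒳 → ℝ≥0) : ℝ≥0∞ :=
  ⨅ k, klI μ N p k

/-- Law of the whole data sequence under the labels `Ω`: data vectors at different times are
independent, and the one at time `i + 1` has the label `Ω i`. -/
def pathLaw (μ : Measure 𝒳) (N : Fin K → ℕ) (p : Fin 2 → Fin K → 𝒳 → ℝ≥0) (Ω : ℕ → Label N) :
    Measure (ℕ → Obs 𝒳 N) :=
  Measure.infinitePi fun i => labelLaw μ N p (Ω i)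

/-- The type of the affected sensor at time `t`, when the change point is `ν` and the affected
sensor is of type `k`. -/
def affected (k : Fin K) (ν t : ℕ) : Option (Fin K) := if t < ν then none else some k

/-- The `σ`-algebra generated by the data at the times `1, …, ν - 1`. -/
@[reducible] def pastSigma (𝒳 : Type*) [MeasurableSpace 𝒳] (N : Fin K → ℕ) (ν : ℕ) :
    MeasurableSpace (ℕ → Obs 𝒳 N) :=
  ⨆ (i : ℕ) (_ : i + 1 < ν), MeasurableSpace.comap (fun x => x i) inferInstance

/-- Worst-case average running length: the infimum, over all the label sequences without anomaly,
of the expectation of `τ`. -/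
def WARL (μ : Measure 𝒳) (N : Fin K → ℕ) (p : Fin 2 → Fin K → 𝒳 → ℝ≥0)
    (τ : (ℕ → Obs 𝒳 N) → ℕ∞) : ℝ≥0∞ :=
  ⨅ (Ω : ℕ → Label N) (_ : ∀ i, Ω i ∈ labels N none), ∫⁻ x, (τ x : ℝ≥0∞) ∂(pathLaw μ N p Ω)

/-- Worst-case average detection delay for a static anomaly: the supremum, over the change points
`ν ≥ 1`, the types `k` of the affected sensor and the label sequences, of the essential supremum
of the conditional expectation of `(τ - ν)⁺` given the data at the times `1, …, ν - 1`. -/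
def WADD (μ : Measure 𝒳) (N : Fin K → ℕ) (p : Fin 2 → Fin K → 𝒳 → ℝ≥0)
    (τ : (ℕ → Obs 𝒳 N) → ℕ∞) : ℝ≥0∞ :=
  ⨆ (ν : ℕ) (_ : 1 ≤ ν) (k : Fin K) (Ω : ℕ → Label N)
    (_ : ∀ i, Ω i ∈ labels N (affected k ν (i + 1))),
    essSup (condLExp (pastSigma 𝒳 N ν) (pathLaw μ N p Ω) fun x => (τ x : ℝ≥0∞) - (ν : ℝ≥0∞))
      (pathLaw μ N p Ω)

end UnlabeledQCD

end

/-! Everything rests on symmetry: the mixture likelihood ratios do not change when the data vector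
is permuted, and two labels in the same set differ by a permutation. Hence the law of such a ratio
is the same under each label as under the mixture (`lintegral_labelLaw_eq_mixLaw`), and the unknown
label sequence is harmless.

Run length. Before the change each ratio `L k` has mean at most 1, so its Shiryaev-Roberts process
`R k`, the sum over starting times of products of ratios, grows by at most 1 per step on average.
The exponential of the GM-CuSum statistic is at most `∑ k, R k`, so this sum is at least `K * γ` at
the stopping time `T`. Optional stopping gives `K * γ * P(T ≤ n) ≤ K * E[min T n]`; if `E[T]` is
finite, letting `n` tend to infinity yields `γ ≤ E[T]` (`mul_measure_compl_le_sum`,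
`le_WARL_gmCuSum`).

Delay. With an affected sensor of type `k`, the rule stops no later than the walk of type-`k`
log-likelihood ratios started at the change point reaches `b`. Its steps have mean `I_k ≥ I^*`. The
expected hitting time is bounded by `b / I^* + O(1)` through a potential `V` that loses at least 1
on average per step and is linear up to a bounded term absorbing the overshoot
(`exists_drift_potential`, `setLIntegral_tsum_belowUpTo_le`). The bounded term needs a second moment
of the positive part of the steps. If `I_k = I^*` this is assumed; if `I_k > I^*`, truncating the
ratio from above keeps the mean at least `I^*` and bounds the positive part
(`exists_step_potential`). -/

/-! ### Walks and Shiryaev-Roberts processes along independent coordinates. -/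

section CoordinateSequences

open ProbabilityTheory Measure

/-- The partial sums of `Y` along the coordinates of index at least `j`. -/
noncomputable def walk {E : Type*} (Y : E → ℝ) (j n : ℕ) (x : ℕ → E) : ℝ :=
  ∑ i ∈ Finset.Ico j (j + n), Y (x i)

theorem walk_succ {E : Type*} (Y : E → ℝ) (j n : ℕ) (x : ℕ → E) :
    walk Y j (n + 1) x = walk Y j n x + Y (x (j + n)) := by
  rw [walk, walk, ← add_assoc, Finset.sum_Ico_succ_top (Nat.le_add_right j n)]

/-- The Shiryaev-Roberts process of the likelihood ratio `L`. -/
noncomputable def shiryaevRoberts {E : Type*} (L : E → ℝ≥0∞) : ℕ → (ℕ → E) → ℝ≥0∞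
  | 0, _ => 0
  | n + 1, x => (1 + shiryaevRoberts L n x) * L (x n)

/-- Unfolding the recursion, the process is the sum of these products over all starting times `j <
n`, and all terms are nonnegative. -/
theorem prod_le_shiryaevRoberts {E : Type*} (L : E → ℝ≥0∞) (x : ℕ → E) {j n : ℕ} (h : j < n) :
    ∏ i ∈ Finset.Ico j n, L (x i) ≤ shiryaevRoberts L n x := by
  induction n with
  | zero => omega
  | succ n ih =>
    rw [Finset.prod_Ico_succ_top (Nat.lt_succ_iff.1 h), shiryaevRoberts]
    gcongr
    rcases (Nat.lt_succ_iff.1 h).eq_or_lt with rfl | h'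
    · simp
    · exact (ih h').trans le_add_self

variable {E : Type*} [MeasurableSpace E]

/-- The `σ`-algebra generated by the coordinates of index less than `n`. -/
@[reducible] def coordsBefore (E : Type*) [MeasurableSpace E] (n : ℕ) : MeasurableSpace (ℕ → E) :=
  ⨆ (i : ℕ) (_ : i < n), MeasurableSpace.comap (fun x => x i) inferInstance

theorem coordsBefore_le (n : ℕ) : coordsBefore E n ≤ MeasurableSpace.pi :=
  iSup₂_le fun i _ => (measurable_pi_apply i).comap_le

theorem coordsBefore_mono {m n : ℕ} (h : m ≤ n) : coordsBefore E m ≤ coordsBefore E n :=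
  iSup₂_le fun i hi => le_iSup₂_of_le i (hi.trans_le h) le_rfl

theorem measurable_eval_coordsBefore {i n : ℕ} (h : i < n) :
    Measurable[coordsBefore E n] fun x : ℕ → E => x i := by
  rw [measurable_iff_comap_le]
  exact le_iSup₂_of_le (f := fun (i : ℕ) (_ : i < n) =>
    MeasurableSpace.comap (fun x : ℕ → E => x i) inferInstance) i h le_rfl

variable {P : ℕ → Measure E} [∀ i, IsProbabilityMeasure (P i)]

theorem indepFun_coordsBefore_eval {n : ℕ} {β : Type*} [MeasurableSpace β] {g : (ℕ → E) → β}
    (hg : Measurable[coordsBefore E n] g) :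
    IndepFun g (fun x => x n) (infinitePi P) := by
  have h1 : iIndep (fun i => MeasurableSpace.comap (fun x : ℕ → E => x i) inferInstance)
      (infinitePi P) :=
    (iIndepFun_infinitePi (P := P) (X := fun _ ω => ω) fun _ => measurable_id).iIndep
  have h2 := indep_iSup_of_disjoint (fun i => (measurable_pi_apply i).comap_le) h1
    (S := {i | i < n}) (T := {n}) (by simp)
  rw [IndepFun_iff_Indep]
  refine indep_of_indep_of_le_left (indep_of_indep_of_le_right h2 ?_) ?_
  · exact le_iSup₂_of_le (f := fun (i : ℕ) (_ : i ∈ ({n} : Set ℕ)) =>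
      MeasurableSpace.comap (fun x : ℕ → E => x i) inferInstance) n rfl le_rfl
  · exact hg.comap_le

/-- Fubini for the past and an independent new coordinate. It plays the role of conditioning on the
past in the supermartingale arguments below. -/
theorem lintegral_coordsBefore_eval {n : ℕ} {β : Type*} [MeasurableSpace β] {g : (ℕ → E) → β}
    (hg : Measurable[coordsBefore E n] g) {F : β → E → ℝ≥0∞}
    (hF : Measurable (Function.uncurry F)) :
    ∫⁻ x, F (g x) (x n) ∂infinitePi P = ∫⁻ x, ∫⁻ y, F (g x) y ∂P n ∂infinitePi P := by
  have hg' : Measurable g := hg.mono (coordsBefore_le n) le_rfl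
  have h := (indepFun_coordsBefore_eval (P := P) hg).map_prod_eq_prod_map_map hg'.aemeasurable
    (measurable_pi_apply n).aemeasurable
  rw [infinitePi_map_eval] at h
  have : IsProbabilityMeasure (map g (infinitePi P)) := isProbabilityMeasure_map hg'.aemeasurable
  calc ∫⁻ x, F (g x) (x n) ∂infinitePi P
      = ∫⁻ z, Function.uncurry F z ∂(map (fun x => (g x, x n)) (infinitePi P)) :=
        (lintegral_map hF (hg'.prodMk (measurable_pi_apply n))).symm
    _ = ∫⁻ a, ∫⁻ y, F a y ∂P n ∂(map g (infinitePi P)) := by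
        rw [h, lintegral_prod _ hF.aemeasurable]; rfl
    _ = _ := lintegral_map hF.lintegral_prod_right' hg'

theorem measurable_walk {Y : E → ℝ} (hY : Measurable Y) (j n : ℕ) :
    Measurable[coordsBefore E (j + n)] (walk Y j n) := by
  unfold walk
  refine Finset.measurable_fun_sum _ fun i hi => ?_
  exact hY.comp (measurable_eval_coordsBefore (Finset.mem_Ico.1 hi).2)

/-- The event that the walk stays below `b` at all the times `1, …, n`. -/
def belowUpTo (Y : E → ℝ) (b : ℝ) (j n : ℕ) : Set (ℕ → E) :=
  {x | ∀ m ∈ Finset.Icc 1 n, walk Y j m x < b}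

theorem measurableSet_belowUpTo {Y : E → ℝ} (hY : Measurable Y) (b : ℝ) (j n : ℕ) :
    MeasurableSet[coordsBefore E (j + n)] (belowUpTo Y b j n) := by
  have : belowUpTo Y b j n = ⋂ m ∈ Finset.Icc 1 n, {x | walk Y j m x < b} := by
    ext x; simp [belowUpTo]
  rw [this]
  refine MeasurableSet.biInter (Finset.countable_toSet _) fun m hm => ?_
  exact coordsBefore_mono (Nat.add_le_add_left (Finset.mem_Icc.1 hm).2 j) _
    (measurable_walk hY j m measurableSet_Iio)

/-- A walk whose steps decrease the potential `V` of the distance to the level `b` by at least one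
on average needs on average at most `V b` steps to reach `b`, also conditionally on the past. -/
theorem setLIntegral_tsum_belowUpTo_le {Y : E → ℝ} (hY : Measurable Y) {V : ℝ → ℝ≥0∞}
    (hV : Measurable V) {j : ℕ} {b : ℝ} (hb : 0 < b)
    (hdrift : ∀ i, j ≤ i → ∀ u, 0 < u → ∫⁻ y, V (u - Y y) ∂P i + 1 ≤ V u)
    {s : Set (ℕ → E)} (hs : MeasurableSet[coordsBefore E j] s) :
    ∫⁻ x in s, ∑' n, (belowUpTo Y b j n).indicator 1 x ∂infinitePi P ≤
      V b * infinitePi P s := by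
  set A := belowUpTo Y b j with hA
  have hAm : ∀ n, MeasurableSet (A n) := fun n =>
    coordsBefore_le _ _ (measurableSet_belowUpTo hY b j n)
  have hsm : MeasurableSet s := coordsBefore_le _ _ hs
  have hAs : ∀ n, MeasurableSet[coordsBefore E (j + n)] (s ∩ A n) := fun n =>
    MeasurableSet.inter (coordsBefore_mono (Nat.le_add_right j n) _ hs)
      (measurableSet_belowUpTo hY b j n)
  -- Supermartingale bound for the stopped process "potential plus elapsed time". Dropping the
  -- potential term and letting `n` tend to infinity gives the claim.
  have key : ∀ n, ∫⁻ x in s ∩ A n, V (b - walk Y j n x) ∂infinitePi P +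
      ∑ m ∈ Finset.range n, infinitePi P (s ∩ A m) ≤ V b * infinitePi P s := by
    intro n
    induction n with
    | zero =>
      have : A 0 = Set.univ := by ext x; simp [hA, belowUpTo]
      simp [this, walk]
    | succ n ih =>
      refine le_trans ?_ ih
      rw [Finset.sum_range_succ, ← add_assoc, add_right_comm]
      gcongr
      have hsub : s ∩ A (n + 1) ⊆ s ∩ A n := by
        refine Set.inter_subset_inter_right _ fun x hx m hm => hx m ?_
        simp only [Finset.mem_Icc] at hm ⊢; omega
      have hpos : ∀ x ∈ s ∩ A n, 0 < b - walk Y j n x := by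
        intro x hx
        rcases Nat.eq_zero_or_pos n with rfl | hn
        · simpa [walk] using hb
        · exact sub_pos.2 (hx.2 n (Finset.mem_Icc.2 ⟨hn, le_rfl⟩))
      -- Both the event and the remaining distance are functions of the coordinates before `j + n`,
      -- so the next step can be integrated out.
      set g : (ℕ → E) → ℝ≥0∞ × ℝ := fun x => ((s ∩ A n).indicator 1 x, b - walk Y j n x) with hg
      have hgm : Measurable[coordsBefore E (j + n)] g := by
        refine Measurable.prodMk ?_ ?_
        · exact Measurable.indicator measurable_const (hAs n)
        · exact Measurable.const_sub (measurable_walk hY j n) b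
      have hFm : Measurable (Function.uncurry fun (a : ℝ≥0∞ × ℝ) (y : E) =>
          a.1 * V (a.2 - Y y)) := by
        unfold Function.uncurry
        fun_prop
      have step := lintegral_coordsBefore_eval (P := P) hgm hFm
      have e1 : ∫⁻ x in s ∩ A n, V (b - walk Y j (n + 1) x) ∂infinitePi P =
          ∫⁻ x, (g x).1 * V ((g x).2 - Y (x (j + n))) ∂infinitePi P := by
        rw [← lintegral_indicator (hsm.inter (hAm n))]
        refine lintegral_congr fun x => ?_
        by_cases hx : x ∈ s ∩ A n
        · simp [hg, hx, walk_succ, sub_sub]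
        · simp [hg, hx]
      have e2 : ∫⁻ x, ∫⁻ y, (g x).1 * V ((g x).2 - Y y) ∂P (j + n) ∂infinitePi P =
          ∫⁻ x in s ∩ A n, ∫⁻ y, V (b - walk Y j n x - Y y) ∂P (j + n) ∂infinitePi P := by
        rw [← lintegral_indicator (hsm.inter (hAm n))]
        refine lintegral_congr fun x => ?_
        by_cases hx : x ∈ s ∩ A n
        · simp [hg, hx]
        · simp [hg, hx]
      calc ∫⁻ x in s ∩ A (n + 1), V (b - walk Y j (n + 1) x) ∂infinitePi P +
            infinitePi P (s ∩ A n)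
          ≤ ∫⁻ x in s ∩ A n, V (b - walk Y j (n + 1) x) ∂infinitePi P +
            ∫⁻ x in s ∩ A n, 1 ∂infinitePi P := by
            rw [setLIntegral_one]
            gcongr
        _ = ∫⁻ x in s ∩ A n, (∫⁻ y, V (b - walk Y j n x - Y y) ∂P (j + n) + 1)
              ∂infinitePi P := by
            rw [lintegral_add_right _ measurable_const, e1, step, e2]
        _ ≤ _ := setLIntegral_mono' (hsm.inter (hAm n)) fun x hx =>
            hdrift _ (Nat.le_add_right j n) _ (hpos x hx)
  rw [lintegral_tsum fun n => (measurable_one.indicator (hAm n)).aemeasurable,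
    ENNReal.tsum_eq_iSup_nat]
  refine iSup_le fun n => le_trans (Finset.sum_le_sum fun m _ => ?_) (le_add_self.trans (key n))
  rw [lintegral_indicator_one (hAm m), Measure.restrict_apply (hAm m), Set.inter_comm]

theorem measurable_shiryaevRoberts {L : E → ℝ≥0∞} (hL : Measurable L) (n : ℕ) :
    Measurable[coordsBefore E n] (shiryaevRoberts L n) := by
  induction n with
  | zero => exact measurable_const
  | succ n ih =>
    exact ((ih.mono (coordsBefore_mono n.le_succ) le_rfl).const_add 1).mul
      (hL.comp (measurable_eval_coordsBefore n.lt_succ_self))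

/-- The new factor `L (x n)` is independent of `B` and of the process at time `n`, and has mean at
most 1. -/
theorem setLIntegral_shiryaevRoberts_succ_le {L : E → ℝ≥0∞} (hL : Measurable L) {n : ℕ}
    (hL1 : ∫⁻ y, L y ∂P n ≤ 1) {B : Set (ℕ → E)} (hB : MeasurableSet[coordsBefore E n] B) :
    ∫⁻ x in B, shiryaevRoberts L (n + 1) x ∂infinitePi P ≤
      infinitePi P B + ∫⁻ x in B, shiryaevRoberts L n x ∂infinitePi P := by
  have hBm : MeasurableSet B := coordsBefore_le _ _ hB
  set g : (ℕ → E) → ℝ≥0∞ := B.indicator fun x => 1 + shiryaevRoberts L n x with hg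
  have hgm : Measurable[coordsBefore E n] g :=
    Measurable.indicator ((measurable_shiryaevRoberts hL n).const_add 1) hB
  have step := lintegral_coordsBefore_eval (P := P) hgm (F := fun a y => a * L y)
    (by unfold Function.uncurry; fun_prop)
  calc ∫⁻ x in B, shiryaevRoberts L (n + 1) x ∂infinitePi P
      = ∫⁻ x, g x * L (x n) ∂infinitePi P := by
        rw [← lintegral_indicator hBm]
        refine lintegral_congr fun x => ?_
        by_cases hx : x ∈ B <;> simp [hg, hx, shiryaevRoberts]
    _ = ∫⁻ x, g x * ∫⁻ y, L y ∂P n ∂infinitePi P := by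
        rw [step]
        exact lintegral_congr fun x => lintegral_const_mul _ hL
    _ ≤ ∫⁻ x, g x ∂infinitePi P := lintegral_mono fun x => mul_le_of_le_one_right' hL1
    _ = _ := by
        rw [hg, lintegral_indicator hBm, lintegral_add_left measurable_const, setLIntegral_one]

/-- If the sum of the Shiryaev-Roberts processes of `K` likelihood ratios is at least `c` when
a decreasing sequence of events `B` is left, then `c` bounds from below `K` times the expected time
spent in `B`. -/
theorem mul_measure_compl_le_sum {K : ℕ} {L : Fin K → E → ℝ≥0∞} (hL : ∀ k, Measurable (L k))
    (hL1 : ∀ k i, ∫⁻ y, L k y ∂P i ≤ 1) {B : ℕ → Set (ℕ → E)}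
    (hB : ∀ n, MeasurableSet[coordsBefore E n] (B n)) (hB0 : B 0 = Set.univ) (hBanti : Antitone B)
    {c : ℝ≥0∞} (hc : ∀ n, ∀ x ∈ B n, x ∉ B (n + 1) → c ≤ ∑ k, shiryaevRoberts (L k) (n + 1) x)
    (n : ℕ) :
    c * infinitePi P (B n)ᶜ ≤ K * ∑ m ∈ Finset.range n, infinitePi P (B m) := by
  have hBm : ∀ n, MeasurableSet (B n) := fun n => coordsBefore_le _ _ (hB n)
  have hSm : ∀ k n, Measurable (shiryaevRoberts (L k) n) := fun k n =>
    (measurable_shiryaevRoberts (hL k) n).mono (coordsBefore_le n) le_rfl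
  -- The induction needs the mass of the processes still running on `B n`; each step moves the part
  -- on `B n \ B (n + 1)`, where the sum is at least `c`, into the second term.
  suffices h : ∫⁻ x in B n, ∑ k, shiryaevRoberts (L k) n x ∂infinitePi P +
      c * infinitePi P (B n)ᶜ ≤ K * ∑ m ∈ Finset.range n, infinitePi P (B m) from
    le_add_self.trans h
  induction n with
  | zero => simp [hB0, shiryaevRoberts]
  | succ n ih =>
    have hsub := hBanti n.le_succ
    have hcompl : infinitePi P (B (n + 1))ᶜ =
        infinitePi P (B n)ᶜ + infinitePi P (B n \ B (n + 1)) := by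
      rw [← measure_union _ ((hBm n).diff (hBm (n + 1)))]
      · congr 1
        ext x
        have := @hsub x
        simp only [Set.mem_compl_iff, Set.mem_union, Set.mem_sdiff]
        tauto
      · exact Set.disjoint_left.2 fun x h1 h2 => h1 h2.1
    have hsplit : ∫⁻ x in B (n + 1), ∑ k, shiryaevRoberts (L k) (n + 1) x ∂infinitePi P +
        c * infinitePi P (B n \ B (n + 1)) ≤
        ∫⁻ x in B n, ∑ k, shiryaevRoberts (L k) (n + 1) x ∂infinitePi P := by
      rw [← lintegral_inter_add_sdiff _ (B n) (hBm (n + 1)), Set.inter_eq_right.2 hsub]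
      gcongr
      rw [← setLIntegral_const]
      exact setLIntegral_mono' ((hBm n).diff (hBm (n + 1))) fun x hx => hc n x hx.1 hx.2
    have hstep : ∫⁻ x in B n, ∑ k, shiryaevRoberts (L k) (n + 1) x ∂infinitePi P ≤
        K * infinitePi P (B n) + ∫⁻ x in B n, ∑ k, shiryaevRoberts (L k) n x ∂infinitePi P := by
      rw [lintegral_finsetSum _ fun k _ => hSm k _, lintegral_finsetSum _ fun k _ => hSm k _]
      refine (Finset.sum_le_sum fun k _ =>
        setLIntegral_shiryaevRoberts_succ_le (hL k) (hL1 k n) (hB n)).trans ?_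
      simp [Finset.sum_add_distrib]
    rw [hcompl, mul_add, Finset.sum_range_succ, mul_add]
    calc _ = ∫⁻ x in B (n + 1), ∑ k, shiryaevRoberts (L k) (n + 1) x ∂infinitePi P +
          c * infinitePi P (B n \ B (n + 1)) + c * infinitePi P (B n)ᶜ := by ring
      _ ≤ K * infinitePi P (B n) + ∫⁻ x in B n, ∑ k, shiryaevRoberts (L k) n x ∂infinitePi P +
          c * infinitePi P (B n)ᶜ := 
        add_le_add_left (hsplit.trans hstep) _
      _ = K * infinitePi P (B n) + (∫⁻ x in B n, ∑ k, shiryaevRoberts (L k) n x ∂infinitePi P +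
          c * infinitePi P (B n)ᶜ) := by ring
      _ ≤ K * infinitePi P (B n) + K * ∑ m ∈ Finset.range n, infinitePi P (B m) := by gcongr
      _ = _ := add_comm _ _

end CoordinateSequences

/-! ### A potential for walks with positive drift. -/

section DriftPotential

/-- The primitive, vanishing at `0`, of `v ↦ (y - v⁺)⁺`. -/
noncomputable def tailPrimitive (y u : ℝ) : ℝ :=
  if u ≤ 0 then u * max y 0 else (max y 0 ^ 2 - max (y - u) 0 ^ 2) / 2

/-- The function is concave in `u`, since `v ↦ (y - v⁺)⁺` is nonincreasing, and its derivative at `u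
> 0` is `(y - u)⁺`. -/
theorem tailPrimitive_supergradient (y : ℝ) {u : ℝ} (hu : 0 < u) (w : ℝ) :
    tailPrimitive y w ≤ tailPrimitive y u + max (y - u) 0 * (w - u) := by
  unfold tailPrimitive
  rw [if_neg hu.not_ge]
  split_ifs with hw <;> rcases le_total y 0 with h1 | h1 <;>
    rcases le_total (y - u) 0 with h2 | h2 <;> try rcases le_total (y - w) 0 with h3 | h3
  all_goals simp only [max_eq_left, max_eq_right, *]
  all_goals nlinarith [sq_nonneg (y - w), sq_nonneg (u - w), sq_nonneg y]

theorem tailPrimitive_monotone (y : ℝ) : Monotone (tailPrimitive y) := by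
  intro u w huw
  unfold tailPrimitive
  split_ifs with h1 h2 h2
  · gcongr
  · have : max (y - w) 0 ≤ max y 0 := by gcongr; linarith
    have h3 : max (y - w) 0 ^ 2 ≤ max y 0 ^ 2 := by gcongr
    nlinarith [le_max_right y 0]
  · linarith
  · have : max (y - w) 0 ≤ max (y - u) 0 := by gcongr
    have h3 : max (y - w) 0 ^ 2 ≤ max (y - u) 0 ^ 2 := by gcongr
    linarith

theorem tailPrimitive_nonneg (y : ℝ) {u : ℝ} (hu : 0 ≤ u) : 0 ≤ tailPrimitive y u := by
  simpa [tailPrimitive] using tailPrimitive_monotone y hu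

theorem tailPrimitive_le (y u : ℝ) : tailPrimitive y u ≤ max y 0 ^ 2 / 2 := by
  unfold tailPrimitive
  split_ifs with h
  · exact (mul_nonpos_of_nonpos_of_nonneg h (le_max_right _ _)).trans (by positivity)
  · nlinarith [sq_nonneg (max (y - u) 0)]

theorem measurable_tailPrimitive (u : ℝ) : Measurable fun y => tailPrimitive y u := by
  unfold tailPrimitive
  split_ifs <;> fun_prop

variable {E : Type*} [MeasurableSpace E] {P : Measure E} [IsProbabilityMeasure P]

theorem exists_lt_integral_min {Y : E → ℝ} (hY : Integrable Y P) {c : ℝ} (hc : c < ∫ y, Y y ∂P) :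
    ∃ u : ℝ, 0 ≤ u ∧ c < ∫ y, min (Y y) u ∂P := by
  have h : Tendsto (fun n : ℕ => ∫ y, min (Y y) n ∂P) atTop (nhds (∫ y, Y y ∂P)) := by
    refine tendsto_integral_of_dominated_convergence (fun y => |Y y|) (fun n => ?_) hY.abs
      (fun n => ae_of_all _ fun y => ?_) (ae_of_all _ fun y => ?_)
    · exact (hY.inf (integrable_const _)).aestronglyMeasurable
    · rw [Real.norm_eq_abs, abs_le]
      have : (0 : ℝ) ≤ n := n.cast_nonneg
      refine ⟨le_min (neg_abs_le _) ?_, (min_le_left _ _).trans (le_abs_self _)⟩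
      linarith [abs_nonneg (Y y)]
    · obtain ⟨N, hN⟩ := exists_nat_ge (Y y)
      refine tendsto_const_nhds.congr' ?_
      filter_upwards [eventually_ge_atTop N] with n hn
      rw [min_eq_left (hN.trans (by exact_mod_cast hn))]
  obtain ⟨n, hn⟩ := (h.eventually (lt_mem_nhds hc)).exists
  exact ⟨n, n.cast_nonneg, hn⟩

/-- For steps `Y` of mean at least `m > 0` whose positive part has a finite second moment, there is
a potential that decreases by at least one on average at each step of the walk, as long as the
distance `u` to the target is positive, and that exceeds `u / m` by at most a constant. -/
theorem exists_drift_potential {Y : E → ℝ} (hYm : Measurable Y) (hY : Integrable Y P) {m : ℝ}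
    (hm : 0 < m) (hmY : m ≤ ∫ y, Y y ∂P) (h2 : ∫⁻ y, ENNReal.ofReal (Y y) ^ 2 ∂P < ∞) :
    ∃ V : ℝ → ℝ≥0∞, Measurable V ∧ (∀ u, 0 < u → ∫⁻ y, V (u - Y y) ∂P + 1 ≤ V u) ∧
      ∃ C : ℝ≥0, ∀ u, 0 < u → V u ≤ ENNReal.ofReal u / ENNReal.ofReal m + C := by
  have hsq : Integrable (fun y => max (Y y) 0 ^ 2) P := by
    refine ⟨by fun_prop, ?_⟩
    rw [hasFiniteIntegral_iff_ofReal (ae_of_all _ fun y => by positivity)]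
    refine lt_of_le_of_lt (lintegral_mono fun y => ?_) h2
    rw [ENNReal.ofReal_pow (le_max_right _ _), ENNReal.ofReal_max]
    simp
  have hpos : ∀ u, Integrable (fun y => max (Y y - u) 0) P := fun u =>
    (hY.sub (integrable_const u)).pos_part
  have hpos0 : Integrable (fun y => max (Y y) 0) P := hY.pos_part
  have hψ : ∀ u, Integrable (fun y => tailPrimitive (Y y) u) P := by
    intro u
    refine Integrable.mono' ((hsq.add (hpos0.const_mul |u|)).add (integrable_const 0))
      ((measurable_tailPrimitive u).comp hYm).aestronglyMeasurable (ae_of_all _ fun y => ?_)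
    simp only [Pi.add_apply, add_zero, Real.norm_eq_abs]
    have h0 : 0 ≤ max (Y y) 0 := le_max_right _ _
    rcases le_or_gt 0 u with hu | hu
    · rw [abs_of_nonneg (tailPrimitive_nonneg _ hu)]
      have := tailPrimitive_le (Y y) u
      have h3 : 0 ≤ |u| * max (Y y) 0 := by positivity
      nlinarith [sq_nonneg (max (Y y) 0)]
    · rw [tailPrimitive, if_pos hu.le, abs_mul, abs_of_nonneg h0]
      nlinarith [sq_nonneg (max (Y y) 0)]
  -- Steps capped at `u₀` still have mean above `m / 2`; this cap is what makes room for cutting the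
  -- correction off below `-u₀`.
  obtain ⟨u₀, hu₀, hmin⟩ := exists_lt_integral_min hY (c := m / 2) (by linarith)
  -- `G u` is the expected overshoot of a single step over distance `u`; `Ψ` is its concave
  -- primitive for `u > 0`, continued linearly with slope `G 0` for `u ≤ 0`.
  set G : ℝ → ℝ := fun u => ∫ y, max (Y y - u) 0 ∂P with hG
  set Ψ : ℝ → ℝ := fun u => ∫ y, tailPrimitive (Y y) u ∂P with hΨ
  have hG0 : ∀ u, 0 ≤ G u := fun u => integral_nonneg fun y => le_max_right _ _
  have hΨmono : Monotone Ψ := fun u w h =>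
    integral_mono (hψ u) (hψ w) fun y => tailPrimitive_monotone _ h
  have hΨneg : Ψ (-u₀) = -(u₀ * G 0) := by
    simp only [hΨ, hG, tailPrimitive, neg_nonpos.2 hu₀, if_true, sub_zero]
    rw [integral_const_mul, neg_mul]
  have hΨgrad : ∀ u, 0 < u → ∀ w, Ψ w ≤ Ψ u + G u * (w - u) := by
    intro u hu w
    rw [hΨ, hG, ← integral_mul_const, ← integral_add (hψ u) ((hpos u).mul_const _)]
    exact integral_mono (hψ w) ((hψ u).add ((hpos u).mul_const _)) fun y =>
      tailPrimitive_supergradient _ hu w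
  set S : ℝ := ∫ y, max (Y y) 0 ^ 2 / 2 ∂P with hS
  have hΨle : ∀ u, Ψ u ≤ S := fun u =>
    integral_mono (hψ u) (hsq.div_const 2) fun y => tailPrimitive_le _ _
  -- The correction that pays for the overshoot. The constant `u₀ * G 0 = -Ψ (-u₀)` makes it vanish
  -- at `-u₀`, hence nonnegative; the factor `2 / m` offsets the mean `m / 2` of the capped steps.
  set h : ℝ → ℝ := fun u => if u < -u₀ then 0 else 2 / m * (u₀ * G 0 + Ψ u) with hh
  have hm' : 0 < 2 / m := by positivity
  set B : ℝ := 2 / m * (u₀ * G 0 + S) with hB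
  have hB0 : 0 ≤ B := by
    have : 0 ≤ S := integral_nonneg fun y => by positivity
    have := hG0 0
    positivity
  have hh0 : ∀ u, 0 ≤ h u := by
    intro u
    simp only [hh]
    split_ifs with hu
    · exact le_rfl
    · have := hΨmono (not_lt.1 hu)
      rw [hΨneg] at this
      exact mul_nonneg hm'.le (by linarith)
  have hhB : ∀ u, h u ≤ B := by
    intro u
    simp only [hh]
    split_ifs with hu
    · exact hB0
    · rw [hB]; gcongr; exact hΨle u
  have hhm : Measurable h := by
    refine Measurable.ite measurableSet_Iio measurable_const ?_
    exact (hΨmono.measurable.const_add _).const_mul _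
  -- Above the cutoff this is concavity at `u - y`. Below it the left side is 0, and concavity at
  -- `-u₀` gives `h u ≥ 2 / m * G u * (u + u₀)`.
  have hstep : ∀ u, 0 < u → ∀ y, h (u - y) ≤ h u - 2 / m * G u * min y u₀ := by
    intro u hu y
    have hu' : ¬ u < -u₀ := by linarith
    simp only [hh, if_neg hu']
    have hGm : 0 ≤ 2 / m * G u := mul_nonneg hm'.le (hG0 u)
    split_ifs with hy
    · have h1 := hΨgrad u hu (-u₀)
      rw [hΨneg] at h1
      have h3 : min y u₀ ≤ u + u₀ := (min_le_right _ _).trans (by linarith)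
      have h4 := mul_le_mul_of_nonneg_left h3 hGm
      have h5 := mul_le_mul_of_nonneg_left h1 hm'.le
      nlinarith
    · have h1 := hΨgrad u hu (u - y)
      have h4 := mul_le_mul_of_nonneg_left (min_le_left y u₀) hGm
      have h5 := mul_le_mul_of_nonneg_left h1 hm'.le
      nlinarith
  have hhint : ∀ u, Integrable (fun y => h (u - Y y)) P := fun u =>
    Integrable.of_bound (hhm.comp (by fun_prop)).aestronglyMeasurable B (ae_of_all _ fun y => by
      rw [Real.norm_eq_abs, abs_of_nonneg (hh0 _)]; exact hhB _)
  have hminint : Integrable (fun y => min (Y y) u₀) P := hY.inf (integrable_const _)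
  have hhdrift : ∀ u, 0 < u → ∫ y, h (u - Y y) ∂P ≤ h u - G u := by
    intro u hu
    calc ∫ y, h (u - Y y) ∂P ≤ ∫ y, (h u - 2 / m * G u * min (Y y) u₀) ∂P :=
          integral_mono (hhint u) ((integrable_const _).sub (hminint.const_mul _)) fun y =>
            hstep u hu (Y y)
      _ = h u - 2 / m * G u * ∫ y, min (Y y) u₀ ∂P := by
          rw [integral_sub (integrable_const _) (hminint.const_mul _), integral_const_mul]
          simp
      _ ≤ h u - 2 / m * G u * (m / 2) := by
          have := hG0 u
          gcongr
      _ = h u - G u := by field_simp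
  -- The positive part of the distance falls on average by at least `m`, except for the overshoot `G
  -- u`, which `hhdrift` compensates exactly.
  have hposdrift : ∀ u, ∫ y, max (u - Y y) 0 ∂P ≤ u - m + G u := by
    intro u
    have : ∀ y, max (u - Y y) 0 = u - Y y + max (Y y - u) 0 := by
      intro y
      rcases le_total (Y y) u with h | h
      · rw [max_eq_left (by linarith), max_eq_right (by linarith)]; ring
      · rw [max_eq_right (by linarith), max_eq_left (by linarith)]; ring
    simp_rw [this]
    have hsub : Integrable (fun y => u - Y y) P := (integrable_const u).sub hY
    rw [integral_add hsub (hpos u), integral_sub (integrable_const u) hY]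
    simp only [integral_const, probReal_univ, one_smul]
    linarith
  have hposint : ∀ u, Integrable (fun y => max (u - Y y) 0) P := fun u =>
    ((integrable_const u).sub hY).pos_part
  refine ⟨fun u => ENNReal.ofReal ((max u 0 + h u) / m), by fun_prop, fun u hu => ?_,
    (B / m).toNNReal, fun u hu => ?_⟩
  · have hnn : ∀ u, 0 ≤ (max u 0 + h u) / m := fun u =>
      div_nonneg (add_nonneg (le_max_right _ _) (hh0 u)) hm.le
    have hint : Integrable (fun y => (max (u - Y y) 0 + h (u - Y y)) / m) P :=
      ((hposint u).add (hhint u)).div_const m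
    beta_reduce
    rw [← ofReal_integral_eq_lintegral_ofReal hint (ae_of_all _ fun y => hnn _),
      ← ENNReal.ofReal_one,
      ← ENNReal.ofReal_add (integral_nonneg fun y => hnn _) zero_le_one]
    refine ENNReal.ofReal_le_ofReal ?_
    rw [integral_div, integral_add (hposint u) (hhint u), max_eq_left hu.le, div_add_one hm.ne']
    refine div_le_div_of_nonneg_right ?_ hm.le
    linarith [hhdrift u hu, hposdrift u]
  · beta_reduce
    rw [← ENNReal.ofReal_div_of_pos hm, max_eq_left hu.le]
    change _ ≤ _ + ENNReal.ofReal (B / m)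
    rw [← ENNReal.ofReal_add (by positivity) (by positivity), ← add_div]
    gcongr
    exact hhB u

end DriftPotential

/-! ### Densities of finite product measures. -/

section FiniteProducts

/-- The Lebesgue integral of a product of functions of the single coordinates. -/
theorem lintegral_pi_fin_prod {X : Type*} [MeasurableSpace X] {n : ℕ} {μ : Fin n → Measure X}
    [∀ i, SigmaFinite (μ i)] {f : Fin n → X → ℝ≥0∞} (hf : ∀ i, Measurable (f i)) :
    ∫⁻ x, ∏ i, f i (x i) ∂Measure.pi μ = ∏ i, ∫⁻ y, f i y ∂μ i := by
  induction n with
  | zero => simp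
  | succ n ih =>
    rw [← ((measurePreserving_piFinSuccAbove μ 0).symm).lintegral_comp_emb
      (MeasurableEquiv.measurableEmbedding _)]
    simp_rw [MeasurableEquiv.piFinSuccAbove_symm_apply, Fin.insertNthEquiv,
      Fin.prod_univ_succ, Equiv.coe_fn_mk, Fin.insertNth_zero, Fin.cons_succ,
      Fin.zero_succAbove, cast_eq, Fin.cons_zero]
    rw [← ih fun i => hf _]
    exact lintegral_prod_mul (μ := μ 0) (ν := Measure.pi fun i : Fin n => μ i.succ)
      (hf 0).aemeasurable (g := fun x : Fin n → X => ∏ i, f i.succ (x i))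
      (Finset.measurable_fun_prod _ fun i _ => (hf _).comp (measurable_pi_apply i)).aemeasurable

theorem pi_withDensity_eq {X : Type*} [MeasurableSpace X] (μ : Measure X) [SigmaFinite μ] {n : ℕ}
    {f : Fin n → X → ℝ≥0∞} (hf : ∀ i, Measurable (f i))
    [∀ i, SigmaFinite (μ.withDensity (f i))] :
    Measure.pi (fun i => μ.withDensity (f i)) =
      (Measure.pi fun _ => μ).withDensity fun x => ∏ i, f i (x i) := by
  refine Measure.pi_eq fun s hs => ?_
  rw [withDensity_apply _ (MeasurableSet.univ_pi hs), Measure.restrict_pi_pi,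
    lintegral_pi_fin_prod hf]
  exact Finset.prod_congr rfl fun i _ => (withDensity_apply _ (hs i)).symm

end FiniteProducts

/-! ### Labels and permutations of the data vector. -/

namespace UnlabeledQCD

section Labels

variable {K : ℕ} {N : Fin K → ℕ}

theorem sum_groupSize (hN : ∀ k, 1 ≤ N k) (s : Option (Fin K)) :
    ∑ g, groupSize N s g = ∑ k, N k := by
  rw [Fintype.sum_prod_type, Fin.sum_univ_two, ← Finset.sum_add_distrib]
  refine Finset.sum_congr rfl fun k _ => ?_
  have := hN k
  by_cases h : s = some k <;> simp [groupSize, h]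
  omega

/-- The group sizes add up to `n`, so the sensors can be matched with the disjoint union of blocks
of these sizes. -/
theorem labels_nonempty (hN : ∀ k, 1 ≤ N k) (s : Option (Fin K)) : (labels N s).Nonempty := by
  have hcard : Fintype.card (Fin (∑ k, N k)) = Fintype.card (Σ g, Fin (groupSize N s g)) := by
    simp [Fintype.card_sigma, sum_groupSize hN s]
  let e := Fintype.equivOfCardEq hcard
  refine ⟨fun i => (e i).1, Finset.mem_filter.2 ⟨Finset.mem_univ _, fun g => ?_⟩⟩
  rw [← Fintype.card_fin (groupSize N s g), ← Fintype.card_subtype]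
  refine Fintype.card_congr ((e.subtypeEquiv (q := fun a => a.1 = g) fun i => Iff.rfl).trans ?_)
  exact
    { toFun := fun a => a.2 ▸ a.1.2
      invFun := fun a => ⟨⟨g, a⟩, rfl⟩
      left_inv := by rintro ⟨⟨g', a⟩, rfl⟩; rfl
      right_inv := fun a => rfl }

/-- Corresponding fibres have the same cardinality; bijections between them glue to a permutation.
-/
theorem exists_perm_of_mem_labels {s : Option (Fin K)} {σ σ' : Label N} (h : σ ∈ labels N s)
    (h' : σ' ∈ labels N s) : ∃ e : Equiv.Perm (Fin (∑ k, N k)), σ' = σ ∘ e := by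
  have hfib : ∀ g, Nonempty ({i // σ' i = g} ≃ {i // σ i = g}) := by
    intro g
    refine ⟨Fintype.equivOfCardEq ?_⟩
    rw [Fintype.card_subtype, Fintype.card_subtype, (Finset.mem_filter.1 h).2 g,
      (Finset.mem_filter.1 h').2 g]
  let e := fun g => (hfib g).some
  refine ⟨(Equiv.sigmaFiberEquiv σ').symm.trans
    ((Equiv.sigmaCongrRight e).trans (Equiv.sigmaFiberEquiv σ)), ?_⟩
  funext i
  exact (e (σ' i) ⟨i, rfl⟩).2.symm

theorem comp_mem_labels {s : Option (Fin K)} {σ : Label N} (h : σ ∈ labels N s)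
    (e : Equiv.Perm (Fin (∑ k, N k))) : σ ∘ e ∈ labels N s := by
  refine Finset.mem_filter.2 ⟨Finset.mem_univ _, fun g => ?_⟩
  rw [← (Finset.mem_filter.1 h).2 g, ← Fintype.card_subtype, ← Fintype.card_subtype]
  exact Fintype.card_congr (e.subtypeEquiv fun i => Iff.rfl)

theorem mixDensity_comp_perm {𝒳 : Type*} (p : Fin 2 → Fin K → 𝒳 → ℝ≥0) (s : Option (Fin K))
    (e : Equiv.Perm (Fin (∑ k, N k))) (x : Obs 𝒳 N) :
    mixDensity N p s (x ∘ e) = mixDensity N p s x := by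
  unfold mixDensity
  congr 1
  refine Finset.sum_bij' (fun σ _ => σ ∘ e.symm) (fun σ _ => σ ∘ e)
    (fun σ h => comp_mem_labels h _) (fun σ h => comp_mem_labels h _)
    (fun σ _ => by ext <;> simp) (fun σ _ => by ext <;> simp) fun σ _ => ?_
  unfold labelDensity
  simpa using Equiv.prod_comp e fun i => p ((σ ∘ e.symm) i).1 ((σ ∘ e.symm) i).2 (x i)

theorem logLR_comp_perm {𝒳 : Type*} (p : Fin 2 → Fin K → 𝒳 → ℝ≥0) (k : Fin K)
    (e : Equiv.Perm (Fin (∑ k, N k))) (x : Obs 𝒳 N) :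
    logLR N p k (x ∘ e) = logLR N p k x := by
  simp only [logLR, mixDensity_comp_perm]

end Labels

/-! ### Laws of the data vector and their mixtures. -/

section Laws

variable {𝒳 : Type*} [MeasurableSpace 𝒳] {μ : Measure 𝒳} {K : ℕ} {N : Fin K → ℕ}
  {p : Fin 2 → Fin K → 𝒳 → ℝ≥0}

theorem measurable_labelDensity (hp : ∀ θ k, Measurable (p θ k)) (σ : Label N) :
    Measurable (labelDensity N p σ) := by
  unfold labelDensity
  exact Finset.measurable_fun_prod _ fun i _ => (hp _ _).comp (measurable_pi_apply i)

theorem measurable_mixDensity (hp : ∀ θ k, Measurable (p θ k)) (s : Option (Fin K)) :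
    Measurable (mixDensity N p s) := by
  unfold mixDensity
  exact (Finset.measurable_fun_sum _ fun σ _ => measurable_labelDensity hp σ).const_mul _

theorem measurable_logLR (hp : ∀ θ k, Measurable (p θ k)) (k : Fin K) :
    Measurable (logLR N p k) := by
  have h := fun s => (measurable_mixDensity (N := N) hp s).coe_nnreal_ennreal
  exact ENNReal.measurable_log.comp ((h _).div (h _))

theorem isProbabilityMeasure_withDensity (hp1 : ∀ θ k, ∫⁻ y, (p θ k y : ℝ≥0∞) ∂μ = 1)
    (θ : Fin 2) (k : Fin K) : IsProbabilityMeasure (μ.withDensity fun y => (p θ k y : ℝ≥0∞)) :=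
  ⟨by rw [withDensity_apply _ MeasurableSet.univ, setLIntegral_univ, hp1]⟩

theorem isProbabilityMeasure_labelLaw (hp1 : ∀ θ k, ∫⁻ y, (p θ k y : ℝ≥0∞) ∂μ = 1)
    (σ : Label N) : IsProbabilityMeasure (labelLaw μ N p σ) := by
  have := fun i => isProbabilityMeasure_withDensity hp1 (σ i).1 (σ i).2
  unfold labelLaw
  infer_instance

theorem card_labels_ne_zero (hN : ∀ k, 1 ≤ N k) (s : Option (Fin K)) :
    ((labels N s).card : ℝ≥0∞) ≠ 0 := by
  simpa using (labels_nonempty hN s).ne_empty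

theorem isProbabilityMeasure_mixLaw (hN : ∀ k, 1 ≤ N k)
    (hp1 : ∀ θ k, ∫⁻ y, (p θ k y : ℝ≥0∞) ∂μ = 1) (s : Option (Fin K)) :
    IsProbabilityMeasure (mixLaw μ N p s) := by
  have := isProbabilityMeasure_labelLaw (N := N) hp1
  refine ⟨?_⟩
  simp only [mixLaw, Measure.smul_apply, Measure.finsetSum_apply, measure_univ, smul_eq_mul,
    Finset.sum_const, nsmul_eq_mul, mul_one]
  exact ENNReal.inv_mul_cancel (card_labels_ne_zero hN s) (ENNReal.natCast_ne_top _)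

theorem labelLaw_absolutelyContinuous_mixLaw {s : Option (Fin K)} {σ : Label N}
    (hσ : σ ∈ labels N s) : labelLaw μ N p σ ≪ mixLaw μ N p s := by
  intro t ht
  simp only [mixLaw, Measure.smul_apply, Measure.finsetSum_apply, smul_eq_mul, mul_eq_zero,
    ENNReal.inv_eq_zero, ENNReal.natCast_ne_top, false_or, Finset.sum_eq_zero_iff] at ht
  exact ht σ hσ

variable [SigmaFinite μ]

theorem labelLaw_eq_withDensity (hp : ∀ θ k, Measurable (p θ k))
    (hp1 : ∀ θ k, ∫⁻ y, (p θ k y : ℝ≥0∞) ∂μ = 1) (σ : Label N) :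
    labelLaw μ N p σ =
      (Measure.pi fun _ => μ).withDensity fun x => (labelDensity N p σ x : ℝ≥0∞) := by
  have := fun i => isProbabilityMeasure_withDensity hp1 (σ i).1 (σ i).2
  rw [labelLaw, pi_withDensity_eq μ fun i => (hp _ _).coe_nnreal_ennreal]
  simp [labelDensity]

theorem mixLaw_eq_withDensity (hN : ∀ k, 1 ≤ N k) (hp : ∀ θ k, Measurable (p θ k))
    (hp1 : ∀ θ k, ∫⁻ y, (p θ k y : ℝ≥0∞) ∂μ = 1) (s : Option (Fin K)) :
    mixLaw μ N p s =
      (Measure.pi fun _ => μ).withDensity fun x => (mixDensity N p s x : ℝ≥0∞) := by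
  have hm := fun σ : Label N => (measurable_labelDensity hp σ).coe_nnreal_ennreal
  ext t ht
  have hc : ((labels N s).card : ℝ≥0) ≠ 0 := by
    exact_mod_cast (labels_nonempty hN s).card_ne_zero
  simp only [mixLaw, Measure.smul_apply, Measure.finsetSum_apply, smul_eq_mul, mixDensity,
    labelLaw_eq_withDensity hp hp1, withDensity_apply _ ht, ENNReal.coe_mul,
    ENNReal.coe_inv hc, ENNReal.ofNNReal_finsetSum, ENNReal.coe_natCast]
  rw [lintegral_const_mul _ (Finset.measurable_fun_sum _ fun σ _ => hm σ),
    lintegral_finsetSum _ fun σ _ => hm σ]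

omit [SigmaFinite μ] in
theorem map_labelLaw_comp_perm (hp1 : ∀ θ k, ∫⁻ y, (p θ k y : ℝ≥0∞) ∂μ = 1) (σ : Label N)
    (e : Equiv.Perm (Fin (∑ k, N k))) :
    (labelLaw μ N p σ).map (fun x => x ∘ e) = labelLaw μ N p (σ ∘ e) := by
  have h := fun i => isProbabilityMeasure_withDensity hp1 (σ i).1 (σ i).2
  have h' := fun i => isProbabilityMeasure_withDensity hp1 ((σ ∘ e) i).1 ((σ ∘ e) i).2
  refine (Measure.pi_eq fun t ht => ?_).symm
  have hpre : (fun x : Obs 𝒳 N => x ∘ e) ⁻¹' Set.univ.pi t = Set.univ.pi (t ∘ e.symm) := by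
    ext x
    simp only [Set.mem_preimage, Set.mem_univ_pi, Function.comp_apply]
    exact ⟨fun hx i => by simpa using hx (e.symm i), fun hx i => by simpa using hx (e i)⟩
  rw [Measure.map_apply (by fun_prop) (MeasurableSet.univ_pi ht), hpre, labelLaw,
    Measure.pi_pi, ← Equiv.prod_comp e]
  simp

omit [SigmaFinite μ] in
/-- All the labels of `labels N s` give the same law to a function that is invariant under
permutations of the data vector. -/
theorem lintegral_labelLaw_eq_mixLaw (hN : ∀ k, 1 ≤ N k)
    (hp1 : ∀ θ k, ∫⁻ y, (p θ k y : ℝ≥0∞) ∂μ = 1) {s : Option (Fin K)} {σ : Label N}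
    (hσ : σ ∈ labels N s) {f : Obs 𝒳 N → ℝ≥0∞} (hf : Measurable f)
    (hfs : ∀ (e : Equiv.Perm (Fin (∑ k, N k))) x, f (x ∘ e) = f x) :
    ∫⁻ x, f x ∂labelLaw μ N p σ = ∫⁻ x, f x ∂mixLaw μ N p s := by
  have h : ∀ σ' ∈ labels N s, ∫⁻ x, f x ∂labelLaw μ N p σ' = ∫⁻ x, f x ∂labelLaw μ N p σ := by
    intro σ' hσ'
    obtain ⟨e, rfl⟩ := exists_perm_of_mem_labels hσ hσ'
    rw [← map_labelLaw_comp_perm hp1, lintegral_map hf (by fun_prop)]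
    simp only [hfs]
  rw [mixLaw, lintegral_smul_measure, lintegral_finsetSum_measure, Finset.sum_congr rfl h,
    Finset.sum_const, nsmul_eq_mul, smul_eq_mul, ← mul_assoc,
    ENNReal.inv_mul_cancel (card_labels_ne_zero hN s) (ENNReal.natCast_ne_top _), one_mul]

end Laws

end UnlabeledQCD

/-! ### Extended-real log-likelihood ratios, divergence and truncation. -/

section LogLikelihoodRatio

variable {Ω : Type*} [MeasurableSpace Ω]

theorem EReal.toENNReal_le_abs (z : EReal) : z.toENNReal ≤ z.abs := by
  induction z with
  | bot => simp
  | top => simp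
  | coe x =>
    rw [EReal.real_coe_toENNReal, EReal.abs_def]
    exact ENNReal.ofReal_le_ofReal (le_abs_self x)

theorem EReal.coe_toReal_le_of_ne_bot {z : EReal} (h : z ≠ ⊥) : (z.toReal : EReal) ≤ z := by
  induction z with
  | bot => exact absurd rfl h
  | top => simp
  | coe x => simp

theorem ENNReal.le_one_add_sq (a : ℝ≥0∞) : a ≤ 1 + a ^ 2 := by
  rcases le_total a 1 with h | h
  · exact h.trans le_self_add
  · exact (le_self_pow₀ h two_ne_zero).trans le_add_self

theorem integrable_toReal_of_lintegral_ne_top {P : Measure Ω} {l : Ω → EReal} (hl : Measurable l)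
    (htop : ∀ᵐ x ∂P, l x ≠ ⊤) (hbot : ∀ᵐ x ∂P, l x ≠ ⊥) (hA : ∫⁻ x, (l x).toENNReal ∂P ≠ ∞)
    (hB : ∫⁻ x, (-l x).toENNReal ∂P ≠ ∞) :
    Integrable (fun x => (l x).toReal) P ∧
      ∫ x, (l x).toReal ∂P =
        (∫⁻ x, (l x).toENNReal ∂P).toReal - (∫⁻ x, (-l x).toENNReal ∂P).toReal := by
  have e1 : ∫⁻ x, ENNReal.ofReal (l x).toReal ∂P = ∫⁻ x, (l x).toENNReal ∂P := by
    refine lintegral_congr_ae ?_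
    filter_upwards [htop] with x hx using (EReal.toENNReal_of_ne_top hx).symm
  have e2 : ∫⁻ x, ENNReal.ofReal (-(l x).toReal) ∂P = ∫⁻ x, (-l x).toENNReal ∂P := by
    refine lintegral_congr_ae ?_
    filter_upwards [hbot] with x hx
    rw [EReal.toENNReal_of_ne_top (by simpa using hx), EReal.toReal_neg_eq]
  have hint : Integrable (fun x => (l x).toReal) P := by
    refine ⟨(measurable_ereal_toReal.comp hl).aestronglyMeasurable, ?_⟩
    rw [hasFiniteIntegral_iff_norm]
    refine lt_of_le_of_lt (b := ∫⁻ x, (ENNReal.ofReal (l x).toReal +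
      ENNReal.ofReal (-(l x).toReal)) ∂P) (lintegral_mono fun x => ?_) ?_
    · rw [Real.norm_eq_abs]
      rcases abs_choice (l x).toReal with h | h <;> rw [h]
      · exact le_self_add
      · exact le_add_self
    · rw [lintegral_add_left hl.ereal_toReal.ennreal_ofReal, e1, e2]
      exact ENNReal.add_lt_top.2 ⟨hA.lt_top, hB.lt_top⟩
  exact ⟨hint, by rw [integral_eq_lintegral_pos_part_sub_lintegral_neg_part hint, e1, e2]⟩

section Densities

variable {ρ : Measure Ω} {f g : Ω → ℝ≥0}

theorem ae_withDensity_log_div_ne_bot (hf : Measurable f) :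
    ∀ᵐ x ∂ρ.withDensity fun x => (f x : ℝ≥0∞), ENNReal.log ((f x : ℝ≥0∞) / g x) ≠ ⊥ := by
  rw [ae_withDensity_iff hf.coe_nnreal_ennreal]
  refine ae_of_all _ fun x hx => ?_
  simpa using hx

/-- From `-log (f / g) ≤ g / f`. It makes the negative part of the log-likelihood ratio integrable
with no moment assumption. -/
theorem lintegral_neg_log_div_le (hf : Measurable f) (hg : Measurable g) :
    ∫⁻ x, (-ENNReal.log ((f x : ℝ≥0∞) / g x)).toENNReal ∂ρ.withDensity (fun x => (f x : ℝ≥0∞)) ≤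
      ∫⁻ x, (g x : ℝ≥0∞) ∂ρ := by
  have hm : Measurable fun x => (-ENNReal.log ((f x : ℝ≥0∞) / g x)).toENNReal := by
    have := ENNReal.measurable_log.comp (hf.coe_nnreal_ennreal.div hg.coe_nnreal_ennreal)
    exact this.neg.ereal_toENNReal
  rw [lintegral_withDensity_eq_lintegral_mul _ hf.coe_nnreal_ennreal hm]
  refine lintegral_mono fun x => ?_
  simp only [Pi.mul_apply]
  rcases eq_or_ne (f x) 0 with h | h
  · simp [h]
  rcases eq_or_ne (g x) 0 with h' | h'
  · simp [h', ENNReal.div_zero, h]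
  rw [← ENNReal.coe_div h', ENNReal.log_of_nnreal (div_ne_zero h h'), ← EReal.coe_neg,
    EReal.real_coe_toENNReal]
  have h1 : -Real.log ((f x / g x : ℝ≥0) : ℝ) ≤ ((g x / f x : ℝ≥0) : ℝ) := by
    rw [← Real.log_inv, ← NNReal.coe_inv, inv_div]
    have hpos : (0 : ℝ) < ((g x / f x : ℝ≥0) : ℝ) :=
      NNReal.coe_pos.2 (div_pos (pos_iff_ne_zero.2 h') (pos_iff_ne_zero.2 h))
    linarith [Real.log_le_sub_one_of_pos hpos]
  calc (f x : ℝ≥0∞) * ENNReal.ofReal (-Real.log ((f x / g x : ℝ≥0) : ℝ))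
      ≤ f x * ((g x / f x : ℝ≥0) : ℝ≥0∞) := by
        gcongr
        rw [← ENNReal.ofReal_coe_nnreal]
        exact ENNReal.ofReal_le_ofReal h1
    _ = g x := by rw [← ENNReal.coe_mul, mul_div_cancel₀ _ h]

/-- The Kullback-Leibler divergence of two probability densities is at most the difference of the
expectations of the positive and the negative parts of the log-likelihood ratio. -/
theorem klDiv_withDensity_add_le [SigmaFinite ρ] (hf : Measurable f) (hg : Measurable g)
    (hf1 : ∫⁻ x, (f x : ℝ≥0∞) ∂ρ = 1) (hg1 : ∫⁻ x, (g x : ℝ≥0∞) ∂ρ = 1) :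
    InformationTheory.klDiv (ρ.withDensity fun x => (f x : ℝ≥0∞))
        (ρ.withDensity fun x => (g x : ℝ≥0∞)) +
      ∫⁻ x, (-ENNReal.log ((f x : ℝ≥0∞) / g x)).toENNReal ∂ρ.withDensity (fun x => (f x : ℝ≥0∞)) ≤
    ∫⁻ x, (ENNReal.log ((f x : ℝ≥0∞) / g x)).toENNReal
      ∂ρ.withDensity (fun x => (f x : ℝ≥0∞)) := by
  set P := ρ.withDensity fun x => (f x : ℝ≥0∞) with hP
  set Q := ρ.withDensity fun x => (g x : ℝ≥0∞) with hQ
  set l : Ω → EReal := fun x => ENNReal.log ((f x : ℝ≥0∞) / g x) with hl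
  have hf' := hf.coe_nnreal_ennreal
  have hg' := hg.coe_nnreal_ennreal
  have hfg : Measurable fun x => (f x : ℝ≥0∞) / g x := hf'.div hg'
  have hlm : Measurable l := ENNReal.measurable_log.comp hfg
  have : IsProbabilityMeasure P :=
    ⟨by rw [hP, withDensity_apply _ MeasurableSet.univ, setLIntegral_univ, hf1]⟩
  have : IsProbabilityMeasure Q :=
    ⟨by rw [hQ, withDensity_apply _ MeasurableSet.univ, setLIntegral_univ, hg1]⟩
  -- Only a finite positive part needs an argument; it forces `g ≠ 0` almost everywhere under `P`,
  -- hence `P ≪ Q`, and the divergence is then the mean of `l`.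
  rcases eq_or_ne (∫⁻ x, (l x).toENNReal ∂P) ∞ with hA | hA
  · rw [hA]; exact le_top
  have hB : ∫⁻ x, (-l x).toENNReal ∂P ≠ ∞ :=
    ((lintegral_neg_log_div_le hf hg).trans_lt (by rw [hg1]; exact ENNReal.one_lt_top)).ne
  have htop : ∀ᵐ x ∂P, l x ≠ ⊤ := by
    filter_upwards [ae_lt_top hlm.ereal_toENNReal hA] with x hx
    exact EReal.toENNReal_ne_top_iff.1 hx.ne
  have hbot : ∀ᵐ x ∂P, l x ≠ ⊥ := ae_withDensity_log_div_ne_bot hf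
  have hPQ : P = Q.withDensity fun x => (f x : ℝ≥0∞) / g x := by
    rw [hQ, ← withDensity_mul _ hg' hfg, hP]
    refine withDensity_congr_ae ?_
    rw [hP, ae_withDensity_iff hf'] at htop
    filter_upwards [htop] with x hx
    simp only [Pi.mul_apply]
    rcases eq_or_ne (g x) 0 with h | h
    · by_contra hne
      have hfx : (f x : ℝ≥0∞) ≠ 0 := by
        intro h0; simp [h0, h] at hne
      exact hx hfx (by simp [hl, h, ENNReal.div_zero hfx])
    · rw [ENNReal.mul_div_cancel (by simpa using h) ENNReal.coe_ne_top]
  have hac : P ≪ Q := by rw [hPQ]; exact withDensity_absolutelyContinuous _ _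
  have hllr : llr P Q =ᵐ[P] fun x => (l x).toReal := by
    have h1 : P.rnDeriv Q =ᵐ[P] fun x => (f x : ℝ≥0∞) / g x := by
      refine hac.ae_le ?_
      have := Measure.rnDeriv_withDensity Q hfg
      rwa [← hPQ] at this
    filter_upwards [h1, htop, hbot] with x hx h2 h3
    rw [llr_def]
    simp only [hx, hl]
    rw [ENNReal.log_pos_real (by simpa [hl] using h3) (by simpa [hl] using h2), EReal.toReal_coe]
  obtain ⟨hint, hval⟩ := integrable_toReal_of_lintegral_ne_top hlm htop hbot hA hB
  have hkl := InformationTheory.toReal_klDiv_of_measure_eq hac (by simp)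
  have hklt := InformationTheory.klDiv_ne_top hac ((integrable_congr hllr).2 hint)
  rw [integral_congr_ae hllr, hval] at hkl
  rw [← ENNReal.toReal_le_toReal (ENNReal.add_ne_top.2 ⟨hklt, hB⟩) hA,
    ENNReal.toReal_add hklt hB, hkl]
  simp

end Densities

/-- Cap `l` at a large `n`: by monotone convergence the strict inequality survives, and the positive
part becomes bounded. -/
theorem exists_step_of_lt {P : Measure Ω} [IsProbabilityMeasure P] {l : Ω → EReal}
    (hl : Measurable l) (hbot : ∀ᵐ x ∂P, l x ≠ ⊥) (hB : ∫⁻ x, (-l x).toENNReal ∂P ≠ ∞)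
    {m : ℝ≥0} (hm : m + ∫⁻ x, (-l x).toENNReal ∂P < ∫⁻ x, (l x).toENNReal ∂P) :
    ∃ φ : EReal → ℝ, Measurable φ ∧ Integrable (fun x => φ (l x)) P ∧
      (m : ℝ) ≤ ∫ x, φ (l x) ∂P ∧ ∫⁻ x, ENNReal.ofReal (φ (l x)) ^ 2 ∂P < ∞ ∧
      ∀ z ≠ ⊥, (φ z : EReal) ≤ z := by
  have hcast : ∀ n : ℕ, ((n : ℝ) : EReal).toENNReal = n := fun n => by
    rw [EReal.real_coe_toENNReal, ENNReal.ofReal_natCast]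
  have hmono : ∀ z : EReal, Monotone fun n : ℕ => (min z ((n : ℝ) : EReal)).toENNReal := by
    intro z i j hij
    exact EReal.toENNReal_le_toENNReal (min_le_min_left _ (by exact_mod_cast hij))
  have hmin : ∀ n : ℕ, Measurable fun x => min (l x) ((n : ℝ) : EReal) := fun n =>
    hl.min measurable_const
  have hsup : ∫⁻ x, (l x).toENNReal ∂P =
      ⨆ n : ℕ, ∫⁻ x, (min (l x) ((n : ℝ) : EReal)).toENNReal ∂P := by
    rw [← lintegral_iSup (fun n => (hmin n).ereal_toENNReal) fun i j hij x => hmono (l x) hij]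
    refine lintegral_congr fun x => le_antisymm ?_ ?_
    · generalize l x = z
      induction z with
      | bot => simp
      | top =>
        simp only [min_eq_right le_top, hcast, ENNReal.iSup_natCast, EReal.toENNReal_top, le_refl]
      | coe r =>
        obtain ⟨n, hn⟩ := exists_nat_ge r
        refine le_iSup_of_le n ?_
        rw [min_eq_left (by exact_mod_cast hn)]
    · exact iSup_le fun n => EReal.toENNReal_le_toENNReal (min_le_left _ _)
  rw [hsup, lt_iSup_iff] at hm
  obtain ⟨n, hn⟩ := hm
  -- Since `n ≥ 0`, capping from above leaves the negative part unchanged.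
  have hneg : ∀ z : EReal, (-min z ((n : ℝ) : EReal)).toENNReal = (-z).toENNReal := by
    intro z
    rcases le_total z ((n : ℝ) : EReal) with h | h
    · rw [min_eq_left h]
    · have hn0 : (0 : EReal) ≤ ((n : ℝ) : EReal) := by exact_mod_cast n.cast_nonneg
      rw [min_eq_right h, EReal.toENNReal_of_nonpos (by simp),
        EReal.toENNReal_of_nonpos (by simpa using hn0.trans h)]
  have hle : ∀ z : EReal, (min z ((n : ℝ) : EReal)).toENNReal ≤ n := fun z =>
    (EReal.toENNReal_le_toENNReal (min_le_right z _)).trans_eq (hcast n)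
  have hA : ∫⁻ x, (min (l x) ((n : ℝ) : EReal)).toENNReal ∂P ≠ ∞ := by
    refine ((lintegral_mono fun x => hle (l x)).trans_lt ?_).ne
    simp
  have hmtop : ∀ z : EReal, min z ((n : ℝ) : EReal) ≠ ⊤ := fun z =>
    ((min_le_right _ _).trans_lt (EReal.coe_lt_top _)).ne
  have hmbot : ∀ z : EReal, z ≠ ⊥ → min z ((n : ℝ) : EReal) ≠ ⊥ := fun z hz =>
    (lt_min (bot_lt_iff_ne_bot.2 hz) (EReal.bot_lt_coe _)).ne'
  obtain ⟨hint, hval⟩ := integrable_toReal_of_lintegral_ne_top (hmin n)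
    (ae_of_all _ fun x => hmtop (l x)) (hbot.mono fun x hx => hmbot _ hx) hA
    (by simpa only [hneg] using hB)
  simp only [hneg] at hval
  refine ⟨fun z => (min z ((n : ℝ) : EReal)).toReal,
    measurable_ereal_toReal.comp (measurable_id.min measurable_const), hint, ?_, ?_, ?_⟩
  · have := (ENNReal.toReal_le_toReal (ENNReal.add_ne_top.2 ⟨ENNReal.coe_ne_top, hB⟩) hA).2 hn.le
    rw [ENNReal.toReal_add ENNReal.coe_ne_top hB, ENNReal.coe_toReal] at this
    rw [hval]
    linarith
  · refine (lintegral_mono (g := fun _ => (n : ℝ≥0∞) ^ 2) fun x => ?_).trans_lt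
      (by simp)
    dsimp only
    rw [← EReal.toENNReal_of_ne_top (hmtop _)]
    gcongr
    exact hle _
  · exact fun z hz => (EReal.coe_toReal_le_of_ne_bot (hmbot z hz)).trans (min_le_left _ _)

/-- With equality allowed there is no slack for a cap, so the second moment is assumed and the ratio
itself is used. The value 0 of `EReal.toReal` at `⊤` respects the domination; at `⊥` it does not. -/
theorem exists_step_of_le {P : Measure Ω} [IsProbabilityMeasure P] {l : Ω → EReal}
    (hl : Measurable l) (hbot : ∀ᵐ x ∂P, l x ≠ ⊥) (hB : ∫⁻ x, (-l x).toENNReal ∂P ≠ ∞)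
    (h2 : ∫⁻ x, (l x).abs ^ 2 ∂P < ∞) {m : ℝ≥0}
    (hm : m + ∫⁻ x, (-l x).toENNReal ∂P ≤ ∫⁻ x, (l x).toENNReal ∂P) :
    ∃ φ : EReal → ℝ, Measurable φ ∧ Integrable (fun x => φ (l x)) P ∧
      (m : ℝ) ≤ ∫ x, φ (l x) ∂P ∧ ∫⁻ x, ENNReal.ofReal (φ (l x)) ^ 2 ∂P < ∞ ∧
      ∀ z ≠ ⊥, (φ z : EReal) ≤ z := by
  have hA : ∫⁻ x, (l x).toENNReal ∂P ≠ ∞ := by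
    refine ((lintegral_mono fun x => (EReal.toENNReal_le_abs (l x)).trans
      (ENNReal.le_one_add_sq _)).trans_lt ?_).ne
    rw [lintegral_add_left measurable_const]
    simpa using h2
  have htop : ∀ᵐ x ∂P, l x ≠ ⊤ := by
    filter_upwards [ae_lt_top hl.ereal_toENNReal hA] with x hx
    exact EReal.toENNReal_ne_top_iff.1 hx.ne
  obtain ⟨hint, hval⟩ := integrable_toReal_of_lintegral_ne_top hl htop hbot hA hB
  refine ⟨EReal.toReal, measurable_ereal_toReal, hint, ?_, ?_, fun z hz =>
    EReal.coe_toReal_le_of_ne_bot hz⟩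
  · have := (ENNReal.toReal_le_toReal (ENNReal.add_ne_top.2 ⟨ENNReal.coe_ne_top, hB⟩) hA).2 hm
    rw [ENNReal.toReal_add ENNReal.coe_ne_top hB, ENNReal.coe_toReal] at this
    rw [hval]
    linarith
  · refine lt_of_le_of_lt (lintegral_mono_ae ?_) h2
    filter_upwards [htop] with x hx
    rw [← EReal.toENNReal_of_ne_top hx]
    gcongr
    exact EReal.toENNReal_le_abs _

end LogLikelihoodRatio

/-! ### Conditional bounds and logarithms of products. -/

/-- A conditional expectation is at most `c` if the integrals over the events of the conditioning
`σ`-algebra are at most `c` times their probabilities. -/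
theorem essSup_condLExp_le {Ω : Type*} {m m0 : MeasurableSpace Ω} (hm : m ≤ m0)
    {P : Measure[m0] Ω} [IsProbabilityMeasure P] {X : Ω → ℝ≥0∞} {c : ℝ≥0∞}
    (h : ∀ s, MeasurableSet[m] s → ∫⁻ x in s, X x ∂P ≤ c * P s) :
    essSup (condLExp m P X) P ≤ c := by
  refine essSup_le_of_ae_le _ (ae_le_of_ae_le_trim (hm := hm) ?_)
  refine ae_le_of_forall_setLIntegral_le_of_sigmaFinite (measurable_condLExp m P X)
    fun s hs _ => ?_
  rw [setLIntegral_condLExp_trim hm P X hs, setLIntegral_const, trim_measurableSet_eq hm hs]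
  exact h s hs

theorem EReal.coe_sum_real {ι : Type*} (s : Finset ι) (f : ι → ℝ) :
    ((∑ i ∈ s, f i : ℝ) : EReal) = ∑ i ∈ s, (f i : EReal) := by
  classical
  induction s using Finset.induction_on with
  | empty => simp
  | insert i s hi ih => rw [Finset.sum_insert hi, Finset.sum_insert hi, EReal.coe_add, ih]

theorem ENNReal.log_prod {ι : Type*} (s : Finset ι) (f : ι → ℝ≥0∞) :
    ENNReal.log (∏ i ∈ s, f i) = ∑ i ∈ s, ENNReal.log (f i) := by
  classical
  induction s using Finset.induction_on with
  | empty => simp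
  | insert i s hi ih => rw [Finset.prod_insert hi, Finset.sum_insert hi, ENNReal.log_mul_add, ih]

/-! ### Run length and detection delay of the GM-CuSum rule. -/

namespace UnlabeledQCD

variable {𝒳 : Type*} {K : ℕ} {N : Fin K → ℕ} {p : Fin 2 → Fin K → 𝒳 → ℝ≥0}

/-- The likelihood ratio of the mixture for an affected sensor of type `k` against the mixture
without anomaly. -/
noncomputable def mixRatio (N : Fin K → ℕ) (p : Fin 2 → Fin K → 𝒳 → ℝ≥0) (k : Fin K)
    (x : Obs 𝒳 N) : ℝ≥0∞ :=
  (mixDensity N p (some k) x : ℝ≥0∞) / (mixDensity N p none x : ℝ≥0∞)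

theorem mixRatio_comp_perm (k : Fin K) (e : Equiv.Perm (Fin (∑ k, N k))) (x : Obs 𝒳 N) :
    mixRatio N p k (x ∘ e) = mixRatio N p k x := by
  simp only [mixRatio, mixDensity_comp_perm]

theorem gmStat_le_log_sum_shiryaevRoberts (t : ℕ) (x : ℕ → Obs 𝒳 N) :
    gmStat N p t x ≤ ENNReal.log (∑ k, shiryaevRoberts (mixRatio N p k) t x) := by
  refine iSup_le fun k => iSup_le fun j => ?_
  calc ∑ i ∈ Finset.Ico (j : ℕ) t, logLR N p k (x i)
      = ENNReal.log (∏ i ∈ Finset.Ico (j : ℕ) t, mixRatio N p k (x i)) :=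
        (ENNReal.log_prod _ _).symm
    _ ≤ _ := ENNReal.log_le_log ((prod_le_shiryaevRoberts _ x j.2).trans
        (Finset.single_le_sum (f := fun k => shiryaevRoberts (mixRatio N p k) t x)
          (fun _ _ => zero_le) (Finset.mem_univ k)))

/-- The event that the statistic stays below `b` at all the times `1, …, n`. -/
def quietUpTo (N : Fin K → ℕ) (p : Fin 2 → Fin K → 𝒳 → ℝ≥0) (b : ℝ) (n : ℕ) :
    Set (ℕ → Obs 𝒳 N) :=
  {x | ∀ t ∈ Finset.Icc 1 n, gmStat N p t x < b}

theorem antitone_quietUpTo (b : ℝ) : Antitone (quietUpTo N p b) := by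
  intro m n hmn x hx t ht
  refine hx t ?_
  simp only [Finset.mem_Icc] at ht ⊢
  omega

theorem sum_indicator_quietUpTo_le (b : ℝ) (x : ℕ → Obs 𝒳 N) (n : ℕ) :
    ∑ m ∈ Finset.range n, (quietUpTo N p b m).indicator (1 : (ℕ → Obs 𝒳 N) → ℝ≥0∞) x ≤
      (gmCuSum N p b x : ℝ≥0∞) := by
  induction n with
  | zero => simp
  | succ n ih =>
    by_cases hx : x ∈ quietUpTo N p b n
    · have h1 : ∑ m ∈ Finset.range (n + 1),
          (quietUpTo N p b m).indicator (1 : (ℕ → Obs 𝒳 N) → ℝ≥0∞) x ≤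
          ∑ m ∈ Finset.range (n + 1), 1 :=
        Finset.sum_le_sum fun m _ => Set.indicator_le_self' (fun _ _ => zero_le) x
      refine h1.trans ?_
      have h2 : ((n + 1 : ℕ) : ℕ∞) ≤ gmCuSum N p b x := by
        refine le_iInf₂ fun t ht => ?_
        by_contra hlt
        have hlt : t < n + 1 := by exact_mod_cast not_le.1 hlt
        exact (hx t (Finset.mem_Icc.2 ⟨ht.1, Nat.lt_succ_iff.1 hlt⟩)).not_ge ht.2
      simpa using ENat.toENNReal_le.2 h2
    · rw [Finset.sum_range_succ]
      simpa [hx] using ih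

/-- The detection delay is at most the time that a walk dominated by the log-likelihood ratios of
one type, and started after the time `j`, spends before reaching the threshold. -/
theorem gmCuSum_sub_le_tsum {k : Fin K} {φ : EReal → ℝ} {b : ℝ} {j : ℕ} {x : ℕ → Obs 𝒳 N}
    (hx : ∀ i, j ≤ i → (φ (logLR N p k (x i)) : EReal) ≤ logLR N p k (x i)) :
    (gmCuSum N p b x : ℝ≥0∞) - ((j + 1 : ℕ) : ℝ≥0∞) ≤
      ∑' n, (belowUpTo (fun y => φ (logLR N p k y)) b j n).indicator 1 x := by
  classical
  set A := belowUpTo (fun y => φ (logLR N p k y)) b j with hA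
  by_cases hall : ∀ n, x ∈ A n
  · have : ∀ n, (A n).indicator (1 : (ℕ → Obs 𝒳 N) → ℝ≥0∞) x = 1 := fun n => by simp [hall n]
    simp only [this, ENNReal.tsum_const_eq_top_of_ne_zero one_ne_zero]
    exact le_top
  · push Not at hall
    obtain ⟨hn, hmin⟩ := And.intro (Nat.find_spec hall) (fun m => Nat.find_min hall (m := m))
    set n := Nat.find hall with hndef
    have hlt : ∀ m < n, x ∈ A m := fun m hm => not_not.1 (hmin m hm)
    obtain ⟨t, ht, hbt⟩ : ∃ t ∈ Finset.Icc 1 n, b ≤ walk (fun y => φ (logLR N p k y)) j t x := by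
      simpa [hA, belowUpTo, and_assoc] using hn
    rw [Finset.mem_Icc] at ht
    -- The maximum defining the statistic includes type `k` and starting index `j`, so it dominates
    -- the walk.
    have hτ : gmCuSum N p b x ≤ ((j + n : ℕ) : ℕ∞) := by
      refine (iInf₂_le (j + t) ⟨by omega, ?_⟩).trans (by exact_mod_cast Nat.add_le_add_left ht.2 j)
      refine le_trans ?_ (le_iSup₂_of_le (f := fun (k : Fin K) (i : Fin (j + t)) =>
        ∑ i ∈ Finset.Ico (i : ℕ) (j + t), logLR N p k (x i)) k ⟨j, by omega⟩ le_rfl)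
      refine (EReal.coe_le_coe_iff.2 hbt).trans ?_
      rw [walk, EReal.coe_sum_real]
      exact Finset.sum_le_sum fun i hi => hx i (Finset.mem_Ico.1 hi).1
    have hsum : (n : ℝ≥0∞) ≤ ∑' n, (A n).indicator (1 : (ℕ → Obs 𝒳 N) → ℝ≥0∞) x := by
      refine le_trans (le_of_eq ?_) (ENNReal.sum_le_tsum (Finset.range n))
      rw [Finset.sum_congr rfl fun m hm => Set.indicator_of_mem (hlt m (Finset.mem_range.1 hm)) _]
      simp
    refine le_trans ?_ hsum
    rw [tsub_le_iff_right]
    refine (ENat.toENNReal_le.2 hτ).trans ?_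
    rw [ENat.toENNReal_coe]
    -- With `j + 1 = ν`, the delay is even at most `n - 1`; the spare unit is given away.
    exact_mod_cast (by omega : j + n ≤ n + (j + 1))

variable [MeasurableSpace 𝒳] {μ : Measure 𝒳}

theorem measurable_mixRatio (hp : ∀ θ k, Measurable (p θ k)) (k : Fin K) :
    Measurable (mixRatio N p k) := by
  have h := fun s => (measurable_mixDensity (N := N) hp s).coe_nnreal_ennreal
  exact (h _).div (h _)

theorem measurable_gmStat (hp : ∀ θ k, Measurable (p θ k)) (t : ℕ) :
    Measurable[coordsBefore (Obs 𝒳 N) t] (gmStat N p t) := by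
  unfold gmStat
  refine Measurable.iSup fun k => Measurable.iSup fun j => ?_
  exact Finset.measurable_fun_sum _ fun i hi =>
    (measurable_logLR hp k).comp (measurable_eval_coordsBefore (Finset.mem_Ico.1 hi).2)

theorem measurableSet_quietUpTo (hp : ∀ θ k, Measurable (p θ k)) (b : ℝ) (n : ℕ) :
    MeasurableSet[coordsBefore (Obs 𝒳 N) n] (quietUpTo N p b n) := by
  have : quietUpTo N p b n = ⋂ t ∈ Finset.Icc 1 n, {x | gmStat N p t x < b} := by
    ext x; simp [quietUpTo]
  rw [this]
  refine MeasurableSet.biInter (Finset.countable_toSet _) fun t ht => ?_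
  exact coordsBefore_mono (Finset.mem_Icc.1 ht).2 _ (measurable_gmStat hp t measurableSet_Iio)

variable [SigmaFinite μ]

theorem lintegral_mixDensity (hN : ∀ k, 1 ≤ N k) (hp : ∀ θ k, Measurable (p θ k))
    (hp1 : ∀ θ k, ∫⁻ y, (p θ k y : ℝ≥0∞) ∂μ = 1) (s : Option (Fin K)) :
    ∫⁻ x, (mixDensity N p s x : ℝ≥0∞) ∂Measure.pi (fun _ => μ) = 1 := by
  have := isProbabilityMeasure_mixLaw hN hp1 s
  have h := measure_univ (μ := mixLaw μ N p s)
  rwa [mixLaw_eq_withDensity hN hp hp1, withDensity_apply _ MeasurableSet.univ,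
    setLIntegral_univ] at h

/-- By symmetry the label may be replaced by the mixture. The integral is then the mass of the
type-`k` mixture where the null mixture density is positive, so it can be less than 1. -/
theorem lintegral_mixRatio_le_one (hN : ∀ k, 1 ≤ N k) (hp : ∀ θ k, Measurable (p θ k))
    (hp1 : ∀ θ k, ∫⁻ y, (p θ k y : ℝ≥0∞) ∂μ = 1) (k : Fin K) {σ : Label N}
    (hσ : σ ∈ labels N none) : ∫⁻ x, mixRatio N p k x ∂labelLaw μ N p σ ≤ 1 := by
  have hm := measurable_mixRatio (N := N) hp k
  rw [lintegral_labelLaw_eq_mixLaw hN hp1 hσ hm (mixRatio_comp_perm k),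
    mixLaw_eq_withDensity hN hp hp1, lintegral_withDensity_eq_lintegral_mul _
      (measurable_mixDensity hp _).coe_nnreal_ennreal hm,
    ← lintegral_mixDensity hN hp hp1 (some k)]
  exact lintegral_mono fun x => ENNReal.mul_div_le

theorem le_WARL_gmCuSum (hK : 1 ≤ K) (hN : ∀ k, 1 ≤ N k) (hp : ∀ θ k, Measurable (p θ k))
    (hp1 : ∀ θ k, ∫⁻ y, (p θ k y : ℝ≥0∞) ∂μ = 1) {γ : ℝ} (hγ : 0 < γ) :
    ENNReal.ofReal γ ≤ WARL μ N p (gmCuSum N p (Real.log (K * γ))) := by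
  refine le_iInf₂ fun Ω hΩ => ?_
  have := isProbabilityMeasure_labelLaw (N := N) hp1
  have hK0 : (0 : ℝ) < K := by exact_mod_cast hK
  set b := Real.log (K * γ) with hb
  set B := quietUpTo N p b with hB
  set P := pathLaw μ N p Ω with hP
  have : IsProbabilityMeasure P := by rw [hP, pathLaw]; infer_instance
  have hBm : ∀ n, MeasurableSet (B n) := fun n =>
    coordsBefore_le _ _ (measurableSet_quietUpTo hp b n)
  set T := ∫⁻ x, (gmCuSum N p b x : ℝ≥0∞) ∂P with hT
  have hsum : ∀ n, ∑ m ∈ Finset.range n, P (B m) ≤ T := by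
    intro n
    rw [Finset.sum_congr rfl fun m _ => (lintegral_indicator_one (hBm m)).symm,
      ← lintegral_finsetSum _ fun m _ => measurable_one.indicator (hBm m)]
    exact lintegral_mono fun x => sum_indicator_quietUpTo_le b x n
  have hcompl : ∀ n, ENNReal.ofReal (K * γ) * P (B n)ᶜ ≤ K * T := by
    intro n
    refine (mul_measure_compl_le_sum (measurable_mixRatio (N := N) hp)
      (fun k i => lintegral_mixRatio_le_one hN hp hp1 k (hΩ i)) (measurableSet_quietUpTo hp b)
      (by ext x; simp [quietUpTo]) (antitone_quietUpTo b) (fun n x hx hx' => ?_) n).trans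
      (mul_le_mul_right (hsum n) _)
    have hstat : (b : EReal) ≤ gmStat N p (n + 1) x := by
      by_contra hlt
      refine hx' fun t ht => ?_
      rw [Finset.mem_Icc] at ht
      rcases ht.2.eq_or_lt with rfl | h
      · exact not_le.1 hlt
      · exact hx t (Finset.mem_Icc.2 ⟨ht.1, Nat.lt_succ_iff.1 h⟩)
    rw [← ENNReal.log_le_log_iff, ENNReal.log_ofReal_of_pos (by positivity)]
    exact hstat.trans (gmStat_le_log_sum_shiryaevRoberts _ x)
  rcases eq_or_ne T ∞ with hTtop | hTtop
  · rw [hTtop]; exact le_top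
  -- A finite expectation makes the probabilities of not having stopped summable.
  have hlim : Tendsto (fun n => P (B n)) atTop (nhds 0) := by
    refine ENNReal.tendsto_atTop_zero_of_tsum_ne_top (ne_top_of_le_ne_top hTtop ?_)
    rw [ENNReal.tsum_eq_iSup_nat]
    exact iSup_le hsum
  have hlim' : Tendsto (fun n => ENNReal.ofReal (K * γ) * P (B n)ᶜ) atTop
      (nhds (ENNReal.ofReal (K * γ) * (1 - 0))) := by
    simp only [prob_compl_eq_one_sub (hBm _)]
    refine ENNReal.Tendsto.const_mul (ENNReal.Tendsto.sub tendsto_const_nhds hlim (by simp)) ?_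
    simp
  have hfin := le_of_tendsto' hlim' hcompl
  rw [tsub_zero, mul_one, ENNReal.ofReal_mul hK0.le, ENNReal.ofReal_natCast] at hfin
  exact (ENNReal.mul_le_mul_iff_right (by exact_mod_cast hK0.ne') (by simp)).1 hfin

/-- For each type `k`, there are steps dominated by the log-likelihood ratio and a potential for
the walk with these steps that grows with slope `1 / m`, for `m` at most `I_k`. -/
theorem exists_step_potential (hN : ∀ k, 1 ≤ N k) (hp : ∀ θ k, Measurable (p θ k))
    (hp1 : ∀ θ k, ∫⁻ y, (p θ k y : ℝ≥0∞) ∂μ = 1) (k : Fin K) {m : ℝ≥0} (hm : m ≠ 0)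
    (hmk : m < klI μ N p k ∨ m = klI μ N p k ∧
      ∫⁻ x, (logLR N p k x).abs ^ 2 ∂mixLaw μ N p (some k) < ∞) :
    ∃ φ : EReal → ℝ, Measurable φ ∧ (∀ z ≠ ⊥, (φ z : EReal) ≤ z) ∧
      ∃ V : ℝ → ℝ≥0∞, Measurable V ∧
        (∀ u, 0 < u → ∫⁻ x, V (u - φ (logLR N p k x)) ∂mixLaw μ N p (some k) + 1 ≤ V u) ∧
        ∃ C : ℝ≥0, ∀ u, 0 < u → V u ≤ ENNReal.ofReal u / m + C := by
  have := isProbabilityMeasure_mixLaw hN hp1 (some k)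
  have hd := fun s => measurable_mixDensity (N := N) hp s
  have hl := measurable_logLR (N := N) hp k
  have hbot : ∀ᵐ x ∂mixLaw μ N p (some k), logLR N p k x ≠ ⊥ := by
    rw [mixLaw_eq_withDensity hN hp hp1]
    exact ae_withDensity_log_div_ne_bot (hd _)
  have hB : ∫⁻ x, (-logLR N p k x).toENNReal ∂mixLaw μ N p (some k) ≠ ∞ := by
    rw [mixLaw_eq_withDensity hN hp hp1]
    refine ((lintegral_neg_log_div_le (hd _) (hd _)).trans_lt ?_).ne
    rw [lintegral_mixDensity hN hp hp1]
    exact ENNReal.one_lt_top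
  have hkl : klI μ N p k + ∫⁻ x, (-logLR N p k x).toENNReal ∂mixLaw μ N p (some k) ≤
      ∫⁻ x, (logLR N p k x).toENNReal ∂mixLaw μ N p (some k) := by
    unfold klI
    rw [mixLaw_eq_withDensity hN hp hp1, mixLaw_eq_withDensity hN hp hp1]
    exact klDiv_withDensity_add_le (hd _) (hd _) (lintegral_mixDensity hN hp hp1 _)
      (lintegral_mixDensity hN hp hp1 _)
  obtain ⟨φ, hφ, hint, hmean, hsq, hle⟩ : ∃ φ : EReal → ℝ, Measurable φ ∧
      Integrable (fun x => φ (logLR N p k x)) (mixLaw μ N p (some k)) ∧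
      (m : ℝ) ≤ ∫ x, φ (logLR N p k x) ∂mixLaw μ N p (some k) ∧
      ∫⁻ x, ENNReal.ofReal (φ (logLR N p k x)) ^ 2 ∂mixLaw μ N p (some k) < ∞ ∧
      ∀ z ≠ ⊥, (φ z : EReal) ≤ z := by
    rcases hmk with h | ⟨h, h2⟩
    · exact exists_step_of_lt hl hbot hB
        (lt_of_lt_of_le ((ENNReal.add_lt_add_iff_right hB).2 h) hkl)
    · exact exists_step_of_le hl hbot hB h2 (h ▸ hkl)
  obtain ⟨V, hV, hdrift, C, hC⟩ := exists_drift_potential (hφ.comp hl) hint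
    (m := m) (NNReal.coe_pos.2 (pos_iff_ne_zero.2 hm)) hmean hsq
  exact ⟨φ, hφ, hle, V, hV, hdrift, C, by simpa using hC⟩

theorem klI_ne_top_of_sq (hN : ∀ k, 1 ≤ N k) (hp : ∀ θ k, Measurable (p θ k))
    (hp1 : ∀ θ k, ∫⁻ y, (p θ k y : ℝ≥0∞) ∂μ = 1) (k : Fin K)
    (h2 : ∫⁻ x, (logLR N p k x).abs ^ 2 ∂mixLaw μ N p (some k) < ∞) : klI μ N p k ≠ ∞ := by
  have := isProbabilityMeasure_mixLaw hN hp1 (some k)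
  have hd := fun s => measurable_mixDensity (N := N) hp s
  have h1 : klI μ N p k ≤ ∫⁻ x, (logLR N p k x).toENNReal ∂mixLaw μ N p (some k) := by
    unfold klI
    rw [mixLaw_eq_withDensity hN hp hp1, mixLaw_eq_withDensity hN hp hp1]
    exact le_self_add.trans (klDiv_withDensity_add_le (hd _) (hd _)
      (lintegral_mixDensity hN hp hp1 _) (lintegral_mixDensity hN hp hp1 _))
  refine (h1.trans_lt ((lintegral_mono fun x => (EReal.toENNReal_le_abs _).trans
    (ENNReal.le_one_add_sq _)).trans_lt ?_)).ne
  rw [lintegral_add_left measurable_const]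
  simpa using h2

theorem WADD_gmCuSum_le (hN : ∀ k, 1 ≤ N k) (hp : ∀ θ k, Measurable (p θ k))
    (hp1 : ∀ θ k, ∫⁻ y, (p θ k y : ℝ≥0∞) ∂μ = 1) {φ : Fin K → EReal → ℝ}
    (hφ : ∀ k, Measurable (φ k)) (hφle : ∀ k, ∀ z ≠ ⊥, (φ k z : EReal) ≤ z)
    {V : Fin K → ℝ → ℝ≥0∞} (hV : ∀ k, Measurable (V k))
    (hdrift : ∀ k u, 0 < u →
      ∫⁻ x, V k (u - φ k (logLR N p k x)) ∂mixLaw μ N p (some k) + 1 ≤ V k u)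
    {b : ℝ} (hb : 0 < b) {c : ℝ≥0∞} (hc : ∀ k, V k b ≤ c) :
    WADD μ N p (gmCuSum N p b) ≤ c := by
  refine iSup₂_le fun ν hν => iSup_le fun k => iSup₂_le fun Ω hΩ => ?_
  obtain ⟨j, rfl⟩ := Nat.exists_eq_add_of_le' hν
  have := isProbabilityMeasure_labelLaw (N := N) hp1
  have hpast : pastSigma 𝒳 N (j + 1) ≤ coordsBefore (Obs 𝒳 N) j :=
    iSup₂_le fun i hi => (measurable_eval_coordsBefore (Nat.lt_of_succ_lt_succ hi)).comap_le
  have hprob : IsProbabilityMeasure (pathLaw μ N p Ω) := by unfold pathLaw; infer_instance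
  have hlab : ∀ i, j ≤ i → Ω i ∈ labels N (some k) := by
    intro i hi
    have := hΩ i
    rwa [affected, if_neg (by omega)] at this
  have hl := measurable_logLR (N := N) hp k
  -- The value `⊥`, where domination may fail, is null under the mixture and hence under each label
  -- of the set.
  have hdom : ∀ᵐ x ∂pathLaw μ N p Ω, ∀ i, j ≤ i →
      (φ k (logLR N p k (x i)) : EReal) ≤ logLR N p k (x i) := by
    rw [ae_all_iff]
    intro i
    by_cases hi : j ≤ i
    · have hbot : ∀ᵐ y ∂mixLaw μ N p (some k), logLR N p k y ≠ ⊥ := by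
        rw [mixLaw_eq_withDensity hN hp hp1]
        exact ae_withDensity_log_div_ne_bot (measurable_mixDensity hp _)
      have h1 := (labelLaw_absolutelyContinuous_mixLaw (μ := μ) (p := p) (hlab i hi)).ae_le hbot
      rw [← Measure.infinitePi_map_eval (fun i => labelLaw μ N p (Ω i)) i] at h1
      filter_upwards [ae_of_ae_map (measurable_pi_apply i).aemeasurable h1] with x hx _
      exact hφle k _ hx
    · exact ae_of_all _ fun x h => absurd h hi
  refine essSup_condLExp_le (hpast.trans (coordsBefore_le j)) fun s hs => ?_
  refine (lintegral_mono_ae ((ae_restrict_of_ae hdom).mono fun x hx =>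
    gmCuSum_sub_le_tsum hx)).trans ?_
  refine (setLIntegral_tsum_belowUpTo_le ((hφ k).comp hl) (hV k) hb (fun i hi u hu => ?_)
    (hpast _ hs)).trans (mul_le_mul_left (hc k) _)
  -- Symmetry turns the drift condition under the mixture into the same condition under the actual
  -- label at each time.
  rw [Function.comp_def, lintegral_labelLaw_eq_mixLaw hN hp1 (hlab i hi)
    (f := fun x => V k (u - φ k (logLR N p k x)))
    ((hV k).comp (((hφ k).comp hl).const_sub u)) fun e x => by rw [logLR_comp_perm]]
  exact hdrift k u hu

end UnlabeledQCD

/-! ### The theorem. -/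

theorem theorem2 {𝒳 : Type*} [MeasurableSpace 𝒳] (μ : Measure 𝒳) [SigmaFinite μ]
    (K : ℕ) (hK : 1 ≤ K) (N : Fin K → ℕ) (hN : ∀ k, 1 ≤ N k)
    (p : Fin 2 → Fin K → 𝒳 → ℝ≥0) (hp : ∀ θ k, Measurable (p θ k))
    (hp1 : ∀ θ k, ∫⁻ y, (p θ k y : ℝ≥0∞) ∂μ = 1) :
    (∀ γ : ℝ, 0 < γ →
      ENNReal.ofReal γ ≤
        UnlabeledQCD.WARL μ N p (UnlabeledQCD.gmCuSum N p (Real.log (K * γ)))) ∧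
    ((∀ k, UnlabeledQCD.klI μ N p k = UnlabeledQCD.klStar μ N p →
        ∫⁻ x, (UnlabeledQCD.logLR N p k x).abs ^ 2
          ∂(UnlabeledQCD.mixLaw μ N p (some k)) < ∞) →
      ∃ C : ℝ≥0, ∀ᶠ γ : ℝ in atTop,
        UnlabeledQCD.WADD μ N p (UnlabeledQCD.gmCuSum N p (Real.log (K * γ))) ≤
          ENNReal.ofReal (Real.log γ) / UnlabeledQCD.klStar μ N p + C) := by
  refine ⟨fun γ hγ => UnlabeledQCD.le_WARL_gmCuSum hK hN hp hp1 hγ, fun h2 => ?_⟩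
  have : Nonempty (Fin K) := ⟨⟨0, hK⟩⟩
  obtain ⟨k₀, hk₀⟩ : ∃ k, UnlabeledQCD.klI μ N p k = UnlabeledQCD.klStar μ N p :=
    exists_eq_ciInf_of_finite
  have htop : UnlabeledQCD.klStar μ N p ≠ ∞ :=
    hk₀ ▸ UnlabeledQCD.klI_ne_top_of_sq hN hp hp1 k₀ (h2 k₀ hk₀)
  have hKlog : 0 ≤ Real.log K := Real.log_nonneg (by exact_mod_cast hK)
  rcases eq_or_ne (UnlabeledQCD.klStar μ N p) 0 with h0 | h0
  · refine ⟨0, ?_⟩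
    filter_upwards [eventually_gt_atTop 1] with γ hγ
    rw [h0, ENNReal.div_zero (by simpa using Real.log_pos hγ), top_add]
    exact le_top
  lift UnlabeledQCD.klStar μ N p to ℝ≥0 using htop with m hm
  have hm0 : m ≠ 0 := by simpa using h0
  have hstep := fun k => UnlabeledQCD.exists_step_potential hN hp hp1 k hm0 (by
    rcases (hm.trans_le (iInf_le _ k)).lt_or_eq with h | h
    · exact Or.inl h
    · exact Or.inr ⟨h, h2 k h.symm⟩)
  choose φ hφ hφle V hV hdrift C hC using hstep
  -- `log K / m` comes from `b = log γ + log K`; the sum of the `C k` dominates each of them,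
  -- uniformly in the affected type.
  refine ⟨Real.toNNReal (Real.log K) / m + ∑ k, C k, ?_⟩
  filter_upwards [eventually_gt_atTop 1] with γ hγ
  have hb : Real.log (K * γ) = Real.log γ + Real.log K := by
    rw [Real.log_mul (by positivity) (by positivity), add_comm]
  have hlog := Real.log_pos hγ
  refine UnlabeledQCD.WADD_gmCuSum_le hN hp hp1 hφ hφle hV hdrift (by linarith) fun k =>
    (hC k _ (by linarith)).trans ?_
  rw [hb, ENNReal.ofReal_add hlog.le hKlog, ENNReal.add_div, add_assoc, ENNReal.coe_add,
    ENNReal.coe_div hm0]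
  gcongr
  · exact le_rfl
  · exact Finset.single_le_sum (f := C) (fun _ _ => zero_le) (Finset.mem_univ k)
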